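/- Let $S^{d-1}$ be the unit sphere of $\mathbb{R}^d$ with its standard inner product $\langle\cdot,\cdot\rangle$ and surface measure. A non-empty finite set $X\subset S^{d-1}$ is a spherical $t$-design if $$\frac1{|X|}\sum_{x\in X}f(x)=\frac1{|S^{d-1}|}\int_{S^{d-1}}f(x)\,dx$$ for every real polynomial $f$ in $d$ variables of degree at most $t$, where $|S^{d-1}|$ is the volume of $S^{d-1}$. For a positive integer $m$, a finite set $X\subset S^{d-1}$ is called an $m$-stiff configuration if it is a spherical $(2m-1)$-design and there is a point $z\in S^{d-1}$ such that the set $\{\langle z,x\rangle : x\in X\}$ has at most $m$ elements. Theorem. Let $n\ge 0$ be an integer. There exists a $(2n+1)$-stiff configuration in $S^7$ if and only if $n=0$ or $n=1$. -/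

import Mathlib

/-- The unit sphere `S^{d-1}` in `d`-dimensional Euclidean space. -/
abbrev UnitSphere (d : ℕ) : Type :=
  Metric.sphere (0 : EuclideanSpace ℝ (Fin d)) 1

/-- The surface measure on `S^{d-1}` (not normalized; its total mass is the volume of `S^{d-1}`). -/
noncomputable def surfaceMeasure (d : ℕ) : MeasureTheory.Measure (UnitSphere d) :=
  (MeasureTheory.volume : MeasureTheory.Measure (EuclideanSpace ℝ (Fin d))).toSphere

/-- The restriction to `S^{d-1}` of a real polynomial in `d` variables. -/
noncomputable def polyOnSphere {d : ℕ} (f : MvPolynomial (Fin d) ℝ) (x : UnitSphere d) : ℝ :=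
  MvPolynomial.eval (fun i => (x : EuclideanSpace ℝ (Fin d)) i) f

/-- A non-empty finite subset `X` of `S^{d-1}` is a spherical `t`-design if, for each polynomial
of degree at most `t`, its average over `X` equals its average over `S^{d-1}`. -/
def IsSphericalDesign {d : ℕ} (t : ℕ) (X : Finset (UnitSphere d)) : Prop :=
  X.Nonempty ∧
    ∀ f : MvPolynomial (Fin d) ℝ, f.totalDegree ≤ t →
      (1 / (X.card : ℝ)) * ∑ x ∈ X, polyOnSphere f x =
        (1 / (surfaceMeasure d).real Set.univ) * ∫ x, polyOnSphere f x ∂(surfaceMeasure d)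

/-- `D(z, X)`, the set of inner products of `z` with the points of `X`. -/
noncomputable def innerProducts {d : ℕ} (z : UnitSphere d) (X : Finset (UnitSphere d)) :
    Finset ℝ :=
  X.image fun (x : UnitSphere d) => inner ℝ (z : EuclideanSpace ℝ (Fin d)) (x : EuclideanSpace ℝ (Fin d))

/-- The set of points `z` of the sphere with `|D(z, X)| ≤ m`. -/
def fewInnerProducts {d : ℕ} (m : ℕ) (X : Finset (UnitSphere d)) : Set (UnitSphere d) :=
  {z | (innerProducts z X).card ≤ m}

/-- For a positive integer `m`, a finite set `X ⊆ S^{d-1}` is `m`-stiff if it is a spherical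
`(2m-1)`-design and some `z ∈ S^{d-1}` has at most `m` distinct inner products with the points
of `X`. -/
def IsStiff {d : ℕ} (m : ℕ) (X : Finset (UnitSphere d)) : Prop :=
  0 < m ∧ IsSphericalDesign (2 * m - 1) X ∧ (fewInnerProducts m X).Nonempty

/-! Non-existence. Let `X` be `m`-stiff in S^7 with `m = 2n + 1`, witnessed by `z`. Projecting `X`
to the line through `z` turns the design property into a positive quadrature formula on at most `m`
nodes, exact to degree `2m - 1`, for the weight (1 - x²)^(5/2). By `gauss_quadrature` the nodes are
the zeros of the Gegenbauer polynomial p of degree `m` and parameter 3, and the weight at a node a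
is inversely proportional to Sonin's function S(a), where S = (1 - x²)p'² + m(m + 6)p². The weights
are proportions of points of `X`, hence rational. Since `m` is odd, 0 is a node, and S(0) is
rational, so S is rational at every node.

Up to a constant, p is x P(4x²) with P an integer polynomial of degree `n`, and S is a rational
polynomial in 4x². As S' = 12 x p'², S is strictly increasing in |x|, so its value determines 4x². A
Galois conjugate of a root y = 4a² of P is again a real root of P with the same rational value of S,
so it equals y. Hence all `n` roots of P are rational (`exists_rat_of_unique_root`); they are
distinct and lie in (0, 4).

This is impossible for `n ≥ 2` (`card_rational_roots_gegenbauerSquare`). By Gauss's lemma the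
product of the denominators divides the leading coefficient ±(n + 1)(2n + 3), while at most three
roots are integers, so 2^(n - 3) ≤ (n + 1)(2n + 3) and `n < 12`. For each remaining `n`, P has no
root modulo a suitable prime.

Existence. For `n = 0` an antipodal pair orthogonal to `z` works. For `n = 1` an explicit 5-design
of 1344 points is given, invariant under all sign changes of coordinates, so only its even moments
up to degree 4 need checking. -/

/-! # Moments of the sphere -/

section

open MeasureTheory Set

/-- The half-line Gaussian moments satisfy `γ (k + 2) = (k + 1) / 2 * γ k`. -/
noncomputable def halfGaussianMoment (k : ℕ) : ℝ :=
  ∫ r in Ioi (0 : ℝ), r ^ k * Real.exp (-r ^ 2)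

/-- The moments of the (unnormalized) Gaussian on the line. -/
noncomputable def gaussianMoment (k : ℕ) : ℝ :=
  ∫ x : ℝ, x ^ k * Real.exp (-x ^ 2)

theorem halfGaussianMoment_eq_Gamma (k : ℕ) :
    halfGaussianMoment k = 1 / 2 * Real.Gamma (((k : ℝ) + 1) / 2) := by
  have h := integral_rpow_mul_exp_neg_rpow (p := 2) (q := k) (by norm_num)
    (by have : (0 : ℝ) ≤ k := k.cast_nonneg
        linarith)
  simpa [halfGaussianMoment] using h

theorem halfGaussianMoment_pos (k : ℕ) : 0 < halfGaussianMoment k := by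
  rw [halfGaussianMoment_eq_Gamma]
  have := Real.Gamma_pos_of_pos (s := ((k : ℝ) + 1) / 2) (by positivity)
  positivity

theorem halfGaussianMoment_add_two (k : ℕ) :
    halfGaussianMoment (k + 2) = (k + 1) / 2 * halfGaussianMoment k := by
  have h := Real.Gamma_add_one (s := ((k : ℝ) + 1) / 2) (by positivity)
  rw [halfGaussianMoment_eq_Gamma, halfGaussianMoment_eq_Gamma]
  have : (((k + 2 : ℕ) : ℝ) + 1) / 2 = ((k : ℝ) + 1) / 2 + 1 := by push_cast; ring
  rw [this, h]
  ring

theorem gaussianMoment_of_odd {k : ℕ} (hk : Odd k) : gaussianMoment k = 0 := by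
  have h := integral_neg_eq_self (fun x : ℝ => x ^ k * Real.exp (-x ^ 2)) volume
  simp only [hk.neg_pow, even_two.neg_pow, neg_mul, integral_neg] at h
  unfold gaussianMoment
  linarith

theorem gaussianMoment_of_even {k : ℕ} (hk : Even k) :
    gaussianMoment k = 2 * halfGaussianMoment k := by
  have h := integral_comp_abs (f := fun x : ℝ => x ^ k * Real.exp (-x ^ 2))
  simp only [hk.pow_abs, sq_abs] at h
  exact h

theorem gaussianMoment_add_two (k : ℕ) :
    gaussianMoment (k + 2) = (k + 1) / 2 * gaussianMoment k := by
  rcases Nat.even_or_odd k with hk | hk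
  · rw [gaussianMoment_of_even hk, gaussianMoment_of_even (hk.add even_two),
      halfGaussianMoment_add_two]
    ring
  · rw [gaussianMoment_of_odd hk, gaussianMoment_of_odd (hk.add_even even_two), mul_zero]

theorem gaussianMoment_zero_pos : 0 < gaussianMoment 0 := by
  rw [gaussianMoment_of_even Even.zero]
  have := halfGaussianMoment_pos 0
  positivity

/-- Polar coordinates for a homogeneous function against the Gaussian. -/
theorem integral_homogeneous_mul_gaussian {d : ℕ} [NeZero d] (k : ℕ)
    (h : EuclideanSpace ℝ (Fin d) → ℝ) (hh : ∀ (r : ℝ) x, h (r • x) = r ^ k * h x) :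
    ∫ x, h x * Real.exp (-‖x‖ ^ 2) =
      (∫ u, h (u : EuclideanSpace ℝ (Fin d)) ∂(surfaceMeasure d)) *
        halfGaussianMoment (k + (d - 1)) := by
  have : Nontrivial (EuclideanSpace ℝ (Fin d)) := by
    have : Nonempty (Fin d) := ⟨0⟩
    infer_instance
  have hd : Module.finrank ℝ (EuclideanSpace ℝ (Fin d)) = d := finrank_euclideanSpace_fin
  have e1 : ∫ x, h x * Real.exp (-‖x‖ ^ 2) =
      ∫ x : ({(0)}ᶜ : Set (EuclideanSpace ℝ (Fin d))), h x.1 * Real.exp (-‖x.1‖ ^ 2)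
          ∂((volume : Measure (EuclideanSpace ℝ (Fin d))).comap (↑)) := by
    rw [integral_subtype_comap (measurableSet_singleton _).compl
      fun x : EuclideanSpace ℝ (Fin d) ↦ h x * Real.exp (-‖x‖ ^ 2), restrict_compl_singleton]
  have e2 := (volume : Measure (EuclideanSpace ℝ (Fin
      d))).measurePreserving_homeomorphUnitSphereProd.integral_comp
        (Homeomorph.measurableEmbedding _)
        (fun p => h (p.1 : EuclideanSpace ℝ (Fin d)) * ((p.2 : ℝ) ^ k * Real.exp (-(p.2 : ℝ) ^ 2)))
  have e3 : ∀ x : ({(0)}ᶜ : Set (EuclideanSpace ℝ (Fin d))), h x.1 * Real.exp (-‖x.1‖ ^ 2) =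
      h ((homeomorphUnitSphereProd (EuclideanSpace ℝ (Fin d)) x).1 : EuclideanSpace ℝ (Fin d)) *
          (((homeomorphUnitSphereProd (EuclideanSpace ℝ (Fin d)) x).2 : ℝ) ^ k *
        Real.exp (-((homeomorphUnitSphereProd (EuclideanSpace ℝ (Fin d)) x).2 : ℝ) ^ 2)) := by
    intro x
    have hx : ‖x.1‖ ≠ 0 := norm_ne_zero_iff.2 x.2
    rw [homeomorphUnitSphereProd_apply_snd_coe, homeomorphUnitSphereProd_apply_fst_coe, hh]
    rw [inv_pow]
    field_simp
  rw [e1, integral_congr_ae (.of_forall e3), e2, integral_prod_mul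
      (fun u : Metric.sphere (0 : EuclideanSpace ℝ (Fin d)) 1 => h u)
    (fun r : Ioi (0 : ℝ) => (r : ℝ) ^ k * Real.exp (-(r : ℝ) ^ 2))]
  congr 1
  simp only [Measure.volumeIoiPow, ENNReal.ofReal]
  rw [integral_withDensity_eq_integral_smul (measurable_subtype_coe.pow_const _).real_toNNReal,
    integral_subtype_comap measurableSet_Ioi fun a : ℝ ↦ Real.toNNReal
        (a ^ (Module.finrank ℝ (EuclideanSpace ℝ (Fin d)) - 1)) •
      (a ^ k * Real.exp (-a ^ 2)), halfGaussianMoment]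
  refine setIntegral_congr_fun measurableSet_Ioi fun x hx ↦ ?_
  simp only [NNReal.smul_def, Real.coe_toNNReal _ (pow_nonneg (le_of_lt hx) _), smul_eq_mul, hd]
  ring

theorem integral_monomial_mul_gaussian {d : ℕ} (a : Fin d → ℕ) :
    ∫ x : EuclideanSpace ℝ (Fin d), (∏ i, x i ^ a i) * Real.exp (-‖x‖ ^ 2) =
      ∏ i, gaussianMoment (a i) := by
  have h := (PiLp.volume_preserving_toLp (Fin d)).integral_comp
    (MeasurableEquiv.toLp 2 (Fin d → ℝ)).measurableEmbedding
    (fun x : EuclideanSpace ℝ (Fin d) => (∏ i, x i ^ a i) * Real.exp (-‖x‖ ^ 2))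
  rw [← h]
  simp only [EuclideanSpace.norm_sq_eq, ← Finset.sum_neg_distrib, Real.exp_sum,
    ← Finset.prod_mul_distrib, Real.norm_eq_abs, sq_abs]
  exact integral_fintype_prod_volume_eq_prod (fun i (x : ℝ) => x ^ a i * Real.exp (-x ^ 2))

theorem integral_sphere_monomial {d : ℕ} [NeZero d] (a : Fin d → ℕ) :
    (∫ u, ∏ i, (u : EuclideanSpace ℝ (Fin d)) i ^ a i ∂(surfaceMeasure d)) *
      halfGaussianMoment (∑ i, a i + (d - 1)) = ∏ i, gaussianMoment (a i) := by
  rw [← integral_monomial_mul_gaussian, ← integral_homogeneous_mul_gaussian _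
    (fun x : EuclideanSpace ℝ (Fin d) => ∏ i, x i ^ a i)]
  intro r x
  simp [mul_pow, Finset.prod_mul_distrib, Finset.prod_pow_eq_pow_sum]

/-- The Gaussian is rotation invariant, so `z` may be replaced by a basis vector, where the Gaussian
integral factors over the coordinates. -/
theorem integral_sphere_inner_pow {d : ℕ} [NeZero d] (z : UnitSphere d) (k : ℕ) :
    (∫ u, inner ℝ (z : EuclideanSpace ℝ (Fin d)) (u : EuclideanSpace ℝ (Fin d)) ^ k
        ∂(surfaceMeasure d)) *
      halfGaussianMoment (k + (d - 1)) = gaussianMoment k * gaussianMoment 0 ^ (d - 1) := by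
  rw [← integral_homogeneous_mul_gaussian _ (fun x : EuclideanSpace ℝ (Fin d) => inner ℝ
      (z : EuclideanSpace ℝ (Fin d)) x ^ k)
    (fun r x => by simp [inner_smul_right, mul_pow])]
  let e : EuclideanSpace ℝ (Fin d) := EuclideanSpace.single 0 1
  have he : ‖(z : EuclideanSpace ℝ (Fin d))‖ = ‖e‖ := by
    rw [PiLp.norm_single, norm_one]
    exact norm_eq_of_mem_sphere z
  -- Reflection in the hyperplane orthogonal to `z - e`, which exchanges the two unit vectors `z`
  -- and `e`.
  let φ : EuclideanSpace ℝ (Fin d) ≃ₗᵢ[ℝ] EuclideanSpace ℝ (Fin d) :=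
      (ℝ ∙ ((z : EuclideanSpace ℝ (Fin d)) - e))ᗮ.reflection
  have hφ : φ z = e := Submodule.reflection_sub he
  have h := φ.measurePreserving.integral_comp φ.toHomeomorph.measurableEmbedding
    (fun x : EuclideanSpace ℝ (Fin d) => (∏ i, x i ^ (if i = 0 then k else 0)) * Real.exp
        (-‖x‖ ^ 2))
  rw [integral_monomial_mul_gaussian] at h
  have h1 : ∀ x : EuclideanSpace ℝ (Fin d), (∏ i, x i ^ (if i = 0 then k else 0)) = inner ℝ e x ^
      k := by
    intro x
    rw [Finset.prod_eq_single 0 (fun b _ hb => by simp [hb]) (by simp)]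
    rw [EuclideanSpace.inner_single_left]
    simp
  have h2 : ∀ x : EuclideanSpace ℝ (Fin d), inner ℝ e (φ x) = inner ℝ
      (z : EuclideanSpace ℝ (Fin d)) x := by
    intro x
    rw [← hφ, φ.inner_map_map]
  simp only [h1, h2, φ.norm_map] at h
  rw [h, ← Finset.mul_prod_erase _ _ (Finset.mem_univ 0),
    Finset.prod_congr rfl (g := fun _ => gaussianMoment 0)]
  · simp
  · intro i hi
    simp [Finset.ne_of_mem_erase hi]

/-- The average of a function over the sphere. -/
noncomputable def sphereAverage {d : ℕ} (f : UnitSphere d → ℝ) : ℝ :=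
  (1 / (surfaceMeasure d).real Set.univ) * ∫ x, f x ∂(surfaceMeasure d)

theorem surfaceMeasure_real_univ {d : ℕ} [NeZero d] :
    (surfaceMeasure d).real univ * halfGaussianMoment (d - 1) = gaussianMoment 0 ^ d := by
  simpa using integral_sphere_monomial (fun _ : Fin d => 0)

theorem surfaceMeasure_real_univ_pos {d : ℕ} [NeZero d] : 0 < (surfaceMeasure d).real univ := by
  have h := surfaceMeasure_real_univ (d := d)
  have h1 := halfGaussianMoment_pos (d - 1)
  have h2 : 0 < gaussianMoment 0 ^ d := pow_pos gaussianMoment_zero_pos d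
  rw [← h] at h2
  exact pos_of_mul_pos_left h2 h1.le

/-- The moments of the projection of the sphere to a line. -/
noncomputable def sphereMoment {d : ℕ} (z : UnitSphere d) (k : ℕ) : ℝ :=
  sphereAverage fun x : UnitSphere d =>
    inner ℝ (z : EuclideanSpace ℝ (Fin d)) (x : EuclideanSpace ℝ (Fin d)) ^ k

theorem sphereMoment_of_odd {d : ℕ} [NeZero d] (z : UnitSphere d) {k : ℕ} (hk : Odd k) :
    sphereMoment z k = 0 := by
  have h := integral_sphere_inner_pow z k
  rw [gaussianMoment_of_odd hk, zero_mul, mul_eq_zero,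
    or_iff_left (halfGaussianMoment_pos _).ne'] at h
  rw [sphereMoment, sphereAverage, h, mul_zero]

theorem sphereMoment_add_two {d : ℕ} [NeZero d] (z : UnitSphere d) (k : ℕ) :
    (k + d) * sphereMoment z (k + 2) = (k + 1) * sphereMoment z k := by
  have h0 := integral_sphere_inner_pow z k
  have h1 := integral_sphere_inner_pow z (k + 2)
  have hd : 1 ≤ d := NeZero.one_le
  rw [gaussianMoment_add_two, add_right_comm, halfGaussianMoment_add_two] at h1
  push_cast [hd] at h1
  have hp := (halfGaussianMoment_pos (k + (d - 1))).ne'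
  rw [sphereMoment, sphereMoment, sphereAverage, sphereAverage]
  have : (k + d : ℝ) * (∫ u, inner ℝ (z : EuclideanSpace ℝ (Fin d))
      (u : EuclideanSpace ℝ (Fin d)) ^ (k + 2) ∂(surfaceMeasure d)) =
      (k + 1) * ∫ u, inner ℝ (z : EuclideanSpace ℝ (Fin d))
      (u : EuclideanSpace ℝ (Fin d)) ^ k ∂(surfaceMeasure d) := by
    apply mul_right_cancel₀ hp
    linear_combination 2 * h1 - (k + 1 : ℝ) * h0
  linear_combination (1 / (surfaceMeasure d).real univ) * this

end

/-! # Gegenbauer polynomials and Gauss quadrature -/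

section

open Polynomial

/-- The Gegenbauer differential operator `(1 - x²) f'' - κ x f'`. -/
noncomputable def gegenbauerOp (κ : ℝ) (f : ℝ[X]) : ℝ[X] :=
  (1 - X ^ 2) * derivative (derivative f) - C κ * X * derivative f

/-- The moment recurrence characterizing, up to scaling, integration against
`(1 - x²) ^ ((κ - 2) / 2)` on `[-1, 1]`. -/
structure IsGegenbauerFunctional (κ : ℝ) (L : ℝ[X] →ₗ[ℝ] ℝ) : Prop where
  one : L X = 0
  add_two : ∀ k : ℕ, (k + κ + 1) * L (X ^ (k + 2)) = (k + 1) * L (X ^ k)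

namespace IsGegenbauerFunctional

variable {κ : ℝ} {L : ℝ[X] →ₗ[ℝ] ℝ}

/-- For the actual weight, the argument of `L` times the weight is the derivative of (1 - x²)^(κ/2)
f, which vanishes at ±1. On monomials the identity is exactly the moment recurrence. -/
theorem integration_by_parts (hL : IsGegenbauerFunctional κ L) (f : ℝ[X]) :
    L ((1 - X ^ 2) * derivative f - C κ * X * f) = 0 := by
  induction f using Polynomial.induction_on' with
  | add p q hp hq =>
    have : (1 - X ^ 2) * derivative (p + q) - C κ * X * (p + q) =
        ((1 - X ^ 2) * derivative p - C κ * X * p) + ((1 - X ^ 2) * derivative q - C κ * X * q) :=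
            by
      rw [derivative_add]
      ring
    rw [this, map_add, hp, hq, add_zero]
  | monomial k a =>
    have key : L ((1 - X ^ 2) * derivative (X ^ k) - C κ * X * X ^ k) = 0 := by
      rcases k with _ | k
      · have : ((1 - X ^ 2) * derivative (X ^ 0) - C κ * X * X ^ 0 : ℝ[X]) = (-κ) • X := by
          simp [smul_eq_C_mul]
        rw [this, map_smul, hL.one, smul_zero]
      · have : ((1 - X ^ 2) * derivative (X ^ (k + 1)) - C κ * X * X ^ (k + 1) : ℝ[X]) =
            ((k : ℝ) + 1) • X ^ k - (k + κ + 1) • X ^ (k + 2) := by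
          simp only [derivative_X_pow, smul_eq_C_mul, Nat.add_sub_cancel]
          push_cast
          simp only [map_add, map_natCast, map_one]
          ring
        rw [this, map_sub, map_smul, map_smul, smul_eq_mul, smul_eq_mul, hL.add_two, sub_self]
    have : ((1 - X ^ 2) * derivative (monomial k a) - C κ * X * monomial k a : ℝ[X]) =
        a • ((1 - X ^ 2) * derivative (X ^ k) - C κ * X * X ^ k) := by
      rw [← C_mul_X_pow_eq_monomial, derivative_C_mul, smul_eq_C_mul]
      ring
    rw [this, map_smul, key, smul_zero]

theorem op_symm (hL : IsGegenbauerFunctional κ L) (f g : ℝ[X]) :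
    L (g * gegenbauerOp κ f) = L (f * gegenbauerOp κ g) := by
  have h1 := hL.integration_by_parts (derivative f * g)
  have h2 := hL.integration_by_parts (derivative g * f)
  rw [← sub_eq_zero, ← map_sub, ← h1.trans h2.symm |> sub_eq_zero.2, ← map_sub]
  congr 1
  simp only [gegenbauerOp, derivative_mul]
  ring

/-- An eigenpolynomial with the eigenvalue of degree `m` is orthogonal to smaller powers. -/
theorem eigen_mul_X_pow (hL : IsGegenbauerFunctional κ L) (hκ : 1 < κ) {m : ℕ} {p : ℝ[X]}
    (hp : gegenbauerOp κ p = C (-(m * (m + κ - 1))) * p) {k : ℕ} (hk : k < m) :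
    L (p * X ^ k) = 0 := by
  induction k using Nat.strong_induction_on with
  | _ k ih =>
    have h := hL.op_symm p (X ^ k)
    have h1 : X ^ k * gegenbauerOp κ p = (-(m * (m + κ - 1))) • (p * X ^ k) := by
      rw [hp, smul_eq_C_mul]
      ring
    have h2 : L (p * gegenbauerOp κ (X ^ k)) = -(k * (k + κ - 1)) * L (p * X ^ k) := by
      rcases k with _ | _ | k
      · simp [gegenbauerOp]
      · have : p * gegenbauerOp κ (X ^ (0 + 1)) = (-κ) • (p * X ^ (0 + 1)) := by
          simp only [gegenbauerOp, smul_eq_C_mul, zero_add, pow_one, derivative_X, derivative_one,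
            map_neg]
          ring
        rw [this, map_smul, smul_eq_mul]
        push_cast
        ring
      · have : p * gegenbauerOp κ (X ^ (k + 1 + 1)) = (((k : ℝ) + 2) * (k + 1)) • (p * X ^ k) +
            (-(((k : ℝ) + 2) * (k + 2 + κ - 1))) • (p * X ^ (k + 1 + 1)) := by
          simp only [gegenbauerOp, smul_eq_C_mul, derivative_X_pow, derivative_mul,
            derivative_natCast, derivative_one, Nat.cast_add, Nat.cast_one, Nat.add_sub_cancel,
                map_neg, map_mul, map_add, map_sub, map_one, map_natCast, map_ofNat]
          ring
        rw [this, map_add, map_smul, map_smul, ih k (by omega) (by omega),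
          smul_zero, zero_add, smul_eq_mul]
        push_cast
        ring
    rw [h1, map_smul, h2, smul_eq_mul] at h
    have hkm : (k : ℝ) < m := by exact_mod_cast hk
    have hk0 : (0 : ℝ) ≤ k := k.cast_nonneg
    -- The coefficient is the difference of the eigenvalues of degrees `m` and `k`. The lower term
    -- of the operator on `X ^ k` was removed by the induction hypothesis.
    have h3 : ((m : ℝ) - k) * (m + k + κ - 1) * L (p * X ^ k) = 0 := by linear_combination -h
    have h4 : ((m : ℝ) - k) * (m + k + κ - 1) ≠ 0 :=
      (mul_pos (by linarith) (by linarith)).ne'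
    exact (mul_eq_zero.1 h3).resolve_left h4

theorem eigen_mul (hL : IsGegenbauerFunctional κ L) (hκ : 1 < κ) {m : ℕ} {p : ℝ[X]}
    (hp : gegenbauerOp κ p = C (-(m * (m + κ - 1))) * p) {g : ℝ[X]} (hg : g.natDegree < m) :
    L (p * g) = 0 := by
  rw [g.as_sum_range_C_mul_X_pow, Finset.mul_sum, map_sum]
  refine Finset.sum_eq_zero fun i hi => ?_
  have : p * (C (g.coeff i) * X ^ i) = g.coeff i • (p * X ^ i) := by
    rw [smul_eq_C_mul]
    ring
  rw [this, map_smul, hL.eigen_mul_X_pow hκ hp (by have := Finset.mem_range.1 hi; omega), smul_zero]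

end IsGegenbauerFunctional

/-- The lowering companion `(1 - x²) p' + m x p` of a Gegenbauer polynomial of degree `m`. -/
noncomputable def gegenbauerLower (m : ℕ) (p : ℝ[X]) : ℝ[X] :=
  (1 - X ^ 2) * derivative p + C (m : ℝ) * X * p

/-- Sonin's function of a Gegenbauer polynomial of degree `m`. -/
noncomputable def sonin (κ : ℝ) (m : ℕ) (p : ℝ[X]) : ℝ[X] :=
  (1 - X ^ 2) * derivative p ^ 2 + C (m * (m + κ - 1)) * p ^ 2

/-- The two contributions to the coefficient of degree `m + 1` cancel. The bound `m` is enough: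
times a factor of degree `m - 1`, it stays within the exactness degree `2m - 1`. -/
theorem natDegree_gegenbauerLower_le {m : ℕ} (hm : 0 < m) {p : ℝ[X]} (hp : p.natDegree ≤ m) :
    (gegenbauerLower m p).natDegree ≤ m := by
  rw [natDegree_le_iff_coeff_eq_zero]
  intro N hN
  obtain ⟨k, rfl⟩ : ∃ k, N = k + 2 := ⟨N - 2, by omega⟩
  have e : gegenbauerLower m p =
      derivative p - derivative p * X ^ 2 + C (m : ℝ) * (p * X) := by
    rw [gegenbauerLower]
    ring
  rw [e, coeff_add, coeff_sub, coeff_C_mul, coeff_mul_X_pow, coeff_mul_X, coeff_derivative,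
    coeff_derivative, coeff_eq_zero_of_natDegree_lt (n := k + 2 + 1) (by omega)]
  rcases eq_or_ne (k + 1) m with rfl | h
  · push_cast
    ring
  · rw [coeff_eq_zero_of_natDegree_lt (n := k + 1) (by omega)]
    ring

/-- Integration by parts moves the derivative from `p` to `g`, leaving `p` against a polynomial of
degree below `m`. Thus `gegenbauerLower` plays the role of the orthogonal polynomial of degree `m -
1`. -/
theorem IsGegenbauerFunctional.lower_mul {κ : ℝ} {L : ℝ[X] →ₗ[ℝ] ℝ}
    (hL : IsGegenbauerFunctional κ L) (hκ : 1 < κ) {m : ℕ} {p : ℝ[X]}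
    (hp : gegenbauerOp κ p = C (-(m * (m + κ - 1))) * p) {g : ℝ[X]} (hg : g.natDegree + 1 < m) :
    L (gegenbauerLower m p * g) = 0 := by
  have h1 := hL.integration_by_parts (p * g)
  have h2 : L (p * (C (m + κ) * X * g - (1 - X ^ 2) * derivative g)) = 0 := by
    apply hL.eigen_mul hκ hp
    refine lt_of_le_of_lt ?_ hg
    refine (natDegree_sub_le _ _).trans (max_le ?_ ?_)
    · compute_degree
      omega
    · rcases Nat.eq_zero_or_pos g.natDegree with h0 | h0
      · rw [natDegree_eq_zero.1 h0 |>.choose_spec.symm]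
        simp
      · have := natDegree_derivative_le g
        refine natDegree_mul_le.trans ?_
        have : (1 - X ^ 2 : ℝ[X]).natDegree ≤ 2 := by compute_degree
        omega
  rw [← add_zero (0 : ℝ)]
  nth_rewrite 1 [← h1]
  rw [← h2, ← map_add]
  congr 1
  simp only [gegenbauerLower, derivative_mul, map_add]
  ring

theorem derivative_sonin {κ : ℝ} {m : ℕ} {p : ℝ[X]}
    (hp : gegenbauerOp κ p = C (-(m * (m + κ - 1))) * p) :
    derivative (sonin κ m p) = C (2 * (κ - 1)) * X * derivative p ^ 2 := by
  unfold gegenbauerOp at hp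
  simp only [sonin, derivative_mul, derivative_add, derivative_pow, derivative_C,
    derivative_one, derivative_X, map_neg, map_mul, map_sub, map_one, Nat.cast_ofNat] at *
  rw [show (C 2 : ℝ[X]) = 2 from rfl]
  simp only [Nat.add_one_sub_one, pow_one]
  linear_combination (2 * derivative p) * hp

/-- The derivative 2(κ - 1) x p'² is nonnegative for x ≥ 0. Equality at two points would make the
polynomial constant on an interval, hence everywhere, forcing p' = 0. -/
theorem sonin_eval_lt {κ : ℝ} (hκ : 1 < κ) {m : ℕ} {p : ℝ[X]} (hp0 : derivative p ≠ 0)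
    (hp : gegenbauerOp κ p = C (-(m * (m + κ - 1))) * p) {a b : ℝ} (ha : 0 ≤ a) (hab : a < b) :
    (sonin κ m p).eval a < (sonin κ m p).eval b := by
  have hd : ∀ x : ℝ, (derivative (sonin κ m p)).eval x =
      2 * (κ - 1) * x * (derivative p).eval x ^ 2 := by
    intro x
    rw [derivative_sonin hp]
    simp
  have hmono : MonotoneOn (fun x => (sonin κ m p).eval x) (Set.Ici 0) := by
    refine monotoneOn_of_deriv_nonneg (convex_Ici 0) (Polynomial.continuousOn _)
      (Polynomial.differentiableOn _) fun x hx => ?_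
    rw [interior_Ici, Set.mem_Ioi] at hx
    rw [Polynomial.deriv, hd]
    have : 0 < κ - 1 := by linarith
    positivity
  refine lt_of_le_of_ne (hmono ha (ha.trans hab.le) hab.le) fun heq => hp0 ?_
  have hconst : sonin κ m p = C ((sonin κ m p).eval a) := by
    refine eq_of_infinite_eval_eq _ _ ((Set.Icc_infinite hab).mono fun x hx => ?_)
    have hx0 : 0 ≤ x := ha.trans hx.1
    simp only [Set.mem_ofPred_eq, eval_C]
    exact le_antisymm ((hmono hx0 (hx0.trans hx.2) hx.2).trans_eq heq.symm) (hmono ha hx0 hx.1)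
  have h := derivative_sonin hp
  rw [hconst, derivative_C] at h
  have h1 : (C (2 * (κ - 1)) : ℝ[X]) ≠ 0 := by
    rw [Ne, C_eq_zero]
    linarith
  exact pow_eq_zero_iff two_ne_zero |>.1
    ((mul_eq_zero.1 h.symm).resolve_left (mul_ne_zero h1 X_ne_zero))

/-- Gauss quadrature for the Gegenbauer weight: a positive quadrature formula on at most `m`
nodes that is exact to degree `2m - 1` has the roots of the Gegenbauer polynomial as nodes, and
its weights are inversely proportional to Sonin's function. -/
theorem gauss_quadrature {κ : ℝ} {L : ℝ[X] →ₗ[ℝ] ℝ} (hL : IsGegenbauerFunctional κ L)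
    (hκ : 1 < κ) {m : ℕ} {p : ℝ[X]} (hdeg : p.natDegree = m)
    (hp : gegenbauerOp κ p = C (-(m * (m + κ - 1))) * p)
    (hS : ∀ x, 0 < (sonin κ m p).eval x)
    {A : Finset ℝ} (hA : A.Nonempty) (hAm : A.card ≤ m) {w : ℝ → ℝ} (hw : ∀ a ∈ A, 0 < w a)
    (hq : ∀ f : ℝ[X], f.natDegree ≤ 2 * m - 1 → L f = ∑ a ∈ A, w a * f.eval a) :
    A.card = m ∧ (∀ x, p.eval x = 0 ↔ x ∈ A) ∧
      ∃ K, ∀ a ∈ A, w a * (sonin κ m p).eval a = K := by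
  have hm : 0 < m := hA.card_pos.trans_le hAm
  have hp0 : p ≠ 0 := by
    rintro rfl
    simp at hdeg
    omega
  let q : ℝ → ℝ[X] := fun a => ∏ b ∈ A.erase a, (X - C b)
  have hqdeg : ∀ a ∈ A, (q a).natDegree + 1 = A.card := by
    intro a ha
    rw [natDegree_prod_of_monic _ _ fun b _ => monic_X_sub_C b]
    simp only [natDegree_X_sub_C, Finset.sum_const, smul_eq_mul, mul_one]
    exact Finset.card_erase_add_one ha
  have hqa : ∀ a, (q a).eval a ≠ 0 := by
    intro a
    rw [eval_prod, Finset.prod_ne_zero_iff]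
    intro b hb
    rw [eval_sub, eval_X, eval_C]
    exact sub_ne_zero.2 (Finset.ne_of_mem_erase hb).symm
  have hsum : ∀ (g r : ℝ[X]), ∀ a ∈ A, (∀ b ∈ A, b ≠ a → r.eval b = 0) → g.natDegree ≤ m →
      r.natDegree + 1 ≤ m → L (g * r) = w a * (g.eval a * r.eval a) := by
    intro g r a ha hr hg hrd
    rw [hq _ (natDegree_mul_le.trans (by omega)), Finset.sum_eq_single a]
    · rw [eval_mul]
    · intro b hb hba
      rw [eval_mul, hr b hb hba, mul_zero, mul_zero]
    · exact fun h => (h ha).elim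
  have hq0 : ∀ a, ∀ b ∈ A, b ≠ a → (q a).eval b = 0 := by
    intro a b hb hba
    rw [eval_prod]
    exact Finset.prod_eq_zero (Finset.mem_erase.2 ⟨hba, hb⟩) (by simp)
  -- Test on `p * q a`: orthogonality makes the integral zero, while the quadrature keeps only the
  -- node `a`.
  have hroot : ∀ a ∈ A, p.eval a = 0 := by
    intro a ha
    have h := hsum p (q a) a ha (hq0 a) hdeg.le (by have := hqdeg a ha; omega)
    rw [hL.eigen_mul hκ hp (by have := hqdeg a ha; omega)] at h
    have := (hw a ha).ne'
    have := hqa a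
    simp_all
  have hG : ∀ a ∈ A, (gegenbauerLower m p).eval a * (derivative p).eval a =
      (sonin κ m p).eval a := by
    intro a ha
    simp only [gegenbauerLower, sonin, eval_add, eval_mul, eval_pow, eval_sub, eval_one, eval_X,
      eval_C, hroot a ha]
    ring
  -- With fewer nodes `q a` has degree below `m - 1`, so `lower_mul` would force `gegenbauerLower m
  -- p` to vanish at `a`, against `hG` and the positivity of Sonin's function.
  have hcard : A.card = m := by
    refine le_antisymm hAm (not_lt.1 fun hlt => ?_)
    obtain ⟨a, ha⟩ := hA
    have h := hsum (gegenbauerLower m p) (q a) a ha (hq0 a)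
      (natDegree_gegenbauerLower_le hm hdeg.le) (by have := hqdeg a ha; omega)
    rw [hL.lower_mul hκ hp (by have := hqdeg a ha; omega)] at h
    have h1 := (hw a ha).ne'
    have h2 := hqa a
    have h3 := (hS a).ne'
    rw [← hG a ha] at h3
    simp_all
  have hroots : A = p.roots.toFinset := by
    refine Finset.eq_of_subset_of_card_le (fun a ha => ?_) ?_
    · rw [Multiset.mem_toFinset, mem_roots hp0]
      exact hroot a ha
    · rw [hcard, ← hdeg]
      exact (Multiset.toFinset_card_le _).trans (card_roots' p)
  refine ⟨hcard, fun x => ?_, p.leadingCoeff * L (gegenbauerLower m p * X ^ (m - 1)), ?_⟩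
  · rw [hroots, Multiset.mem_toFinset, mem_roots hp0, IsRoot.def]
  · intro a ha
    -- With r = p / (X - a), one has r(a) = p'(a), so testing on `gegenbauerLower m p * r` yields
    -- the weight times Sonin's function. By `lower_mul` the integral depends only on the leading
    -- coefficient of r, which is that of p for every node.
    obtain ⟨r, hr⟩ := dvd_iff_isRoot.2 (hroot a ha)
    have hr0 : r ≠ 0 := by
      rintro rfl
      simp [hr] at hp0
    have hrdeg : r.natDegree + 1 = m := by
      rw [← hdeg, hr, natDegree_mul (X_sub_C_ne_zero a) hr0, natDegree_X_sub_C, add_comm]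
    have hlead : r.leadingCoeff = p.leadingCoeff := by
      rw [hr, leadingCoeff_mul, leadingCoeff_X_sub_C, one_mul]
    have hra : r.eval a = (derivative p).eval a := by
      rw [hr]
      simp
    have h := hsum (gegenbauerLower m p) r a ha (fun b hb hba => ?_)
      (natDegree_gegenbauerLower_le hm hdeg.le) hrdeg.le
    · rw [hra, hG a ha] at h
      rw [← h]
      have e : gegenbauerLower m p * r = gegenbauerLower m p * r.eraseLead +
          p.leadingCoeff • (gegenbauerLower m p * X ^ (m - 1)) := by
        conv_lhs => rw [← r.eraseLead_add_C_mul_X_pow]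
        rw [hlead, ← hrdeg, Nat.add_sub_cancel, smul_eq_C_mul]
        ring
      rw [e, map_add, map_smul, smul_eq_mul, add_eq_right]
      rcases Nat.eq_zero_or_pos r.natDegree with h0 | h0
      · rw [natDegree_eq_zero.1 h0 |>.choose_spec.symm, ← monomial_zero_left, eraseLead_monomial,
          mul_zero, map_zero]
      · apply hL.lower_mul hκ hp
        have := eraseLead_natDegree_le r
        omega
    · have := hroot b hb
      rw [hr, eval_mul, eval_sub, eval_X, eval_C] at this
      exact (mul_eq_zero.1 this).resolve_left (sub_ne_zero.2 hba)

end

/-! # Rational roots of the odd Gegenbauer polynomials -/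

section

open Polynomial

/-- The coefficients of `gegenbauerSquare`. -/
def gegenbauerCoeff (n l : ℕ) : ℤ :=
  (-1) ^ l * ((n + l + 3).choose (2 * l + 3) * (l + 1) * (2 * l + 3))

theorem gegenbauerCoeff_of_lt {n l : ℕ} (h : n < l) : gegenbauerCoeff n l = 0 := by
  rw [gegenbauerCoeff, Nat.choose_eq_zero_of_lt (by omega)]
  simp

theorem gegenbauerCoeff_self (n : ℕ) :
    gegenbauerCoeff n n = (-1) ^ n * ((n + 1) * (2 * n + 3)) := by
  rw [gegenbauerCoeff, show n + n + 3 = 2 * n + 3 by ring, Nat.choose_self]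
  push_cast
  ring

theorem gegenbauerCoeff_succ (n l : ℕ) :
    (2 * l + 3) * (2 * l + 2) * gegenbauerCoeff n (l + 1) =
      -((n - l) * (n + l + 4)) * gegenbauerCoeff n l := by
  rcases Nat.lt_or_ge n l with h | h
  · rw [gegenbauerCoeff_of_lt h, gegenbauerCoeff_of_lt (h.trans l.lt_succ_self)]
    ring
  · have h1 := Nat.add_one_mul_choose_eq (n + l + 3) (2 * l + 4)
    have h2 := Nat.choose_succ_right_eq (n + l + 3) (2 * l + 3)
    rw [show n + l + 3 - (2 * l + 3) = n - l by omega] at h2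
    zify [h] at h1 h2
    rw [gegenbauerCoeff, gegenbauerCoeff, show n + (l + 1) + 3 = n + l + 3 + 1 by ring,
      show 2 * (l + 1) + 3 = 2 * l + 4 + 1 by ring]
    push_cast at h1 h2 ⊢
    rw [pow_succ]
    linear_combination (-1) ^ l * (2 * l + 3 : ℤ) * (l + 1) * ((2 * l + 4) * h1 - (n + l + 4) * h2)

/-- The integer polynomial `P` of degree `n` such that `x * P (4 * x ^ 2)` is, up to sign, the
Gegenbauer polynomial of degree `2 * n + 1` and parameter `3`. -/
noncomputable def gegenbauerSquare (n : ℕ) : ℤ[X] :=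
  ∑ l ∈ Finset.range (n + 1), C (gegenbauerCoeff n l) * X ^ l

theorem coeff_gegenbauerSquare (n l : ℕ) :
    (gegenbauerSquare n).coeff l = gegenbauerCoeff n l := by
  simp only [gegenbauerSquare, finsetSum_coeff, coeff_C_mul_X_pow]
  rw [Finset.sum_ite_eq, ite_eq_left_iff, Finset.mem_range]
  exact fun h => (gegenbauerCoeff_of_lt (by omega)).symm

theorem natDegree_gegenbauerSquare (n : ℕ) : (gegenbauerSquare n).natDegree = n := by
  refine natDegree_eq_of_le_of_coeff_ne_zero ?_ ?_
  · rw [natDegree_le_iff_coeff_eq_zero]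
    intro l hl
    rw [coeff_gegenbauerSquare, gegenbauerCoeff_of_lt hl]
  · rw [coeff_gegenbauerSquare, gegenbauerCoeff_self]
    have : ((n : ℤ) + 1) * (2 * n + 3) ≠ 0 := by positivity
    simpa using this

theorem leadingCoeff_gegenbauerSquare (n : ℕ) :
    (gegenbauerSquare n).leadingCoeff = (-1) ^ n * ((n + 1) * (2 * n + 3)) := by
  rw [leadingCoeff, natDegree_gegenbauerSquare, coeff_gegenbauerSquare, gegenbauerCoeff_self]

theorem gegenbauerSquare_ne_zero (n : ℕ) : gegenbauerSquare n ≠ 0 := by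
  rw [← leadingCoeff_ne_zero, leadingCoeff_gegenbauerSquare]
  have : ((n : ℤ) + 1) * (2 * n + 3) ≠ 0 := by positivity
  simpa using this

/-- Coefficientwise this is `gegenbauerCoeff_succ`. Under y = 4x² it becomes the Gegenbauer equation
with κ = 7 for x P(4x²). -/
theorem gegenbauerSquare_ode (n : ℕ) :
    (4 * X - X ^ 2) * derivative (derivative (gegenbauerSquare n)) +
      (6 - 5 * X) * derivative (gegenbauerSquare n) + C ((n : ℤ) * (n + 4)) * gegenbauerSquare n =
        0 := by
  set P := gegenbauerSquare n
  have e : (4 * X - X ^ 2) * derivative (derivative P) + (6 - 5 * X) * derivative P +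
      C ((n : ℤ) * (n + 4)) * P = C 4 * (derivative (derivative P) * X) -
        derivative (derivative P) * X ^ 2 + C 6 * derivative P - C 5 * (derivative P * X) +
        C ((n : ℤ) * (n + 4)) * P := by
    simp only [map_ofNat]
    ring
  rw [e]
  ext l
  have h := gegenbauerCoeff_succ n l
  rcases l with _ | _ | l <;>
  simp only [coeff_add, coeff_sub, coeff_C_mul, coeff_mul_X, coeff_derivative,
    coeff_mul_X_zero, coeff_mul_X_pow', P, coeff_gegenbauerSquare, coeff_zero] at h ⊢ <;>
  norm_num at h ⊢
  · linear_combination h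
  · linear_combination h
  · rw [show l + 1 + 1 - 2 = l by omega]
    linear_combination h

theorem eval_map_gegenbauerSquare {R : Type*} [CommRing R] (n : ℕ) (y : R) :
    ((gegenbauerSquare n).map (Int.castRingHom R)).eval y =
      ∑ l ∈ Finset.range (n + 1), (gegenbauerCoeff n l : R) * y ^ l := by
  simp [gegenbauerSquare, eval_finsetSum, Polynomial.map_sum]

/-! ### Rational roots: denominators and reduction modulo primes. -/

/-- The primitive integer linear polynomial with the rational root `q`. -/
noncomputable def primitiveLinear (q : ℚ) : ℤ[X] := C (q.den : ℤ) * X - C q.num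

theorem map_primitiveLinear (q : ℚ) :
    (primitiveLinear q).map (Int.castRingHom ℚ) = C (q.den : ℚ) * (X - C q) := by
  have : (q.den : ℚ) * q = q.num := Rat.den_mul_eq_num q
  rw [primitiveLinear, Polynomial.map_sub, Polynomial.map_mul, Polynomial.map_C,
    Polynomial.map_C, Polynomial.map_X, mul_sub, ← C_mul, this, eq_intCast, eq_intCast,
    Int.cast_natCast]

theorem leadingCoeff_primitiveLinear (q : ℚ) : (primitiveLinear q).leadingCoeff = q.den := by
  rw [primitiveLinear, sub_eq_add_neg, ← C_neg,
    leadingCoeff_linear (by exact_mod_cast q.den_nz)]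

theorem isPrimitive_primitiveLinear (q : ℚ) : (primitiveLinear q).IsPrimitive := by
  intro r hr
  rw [C_dvd_iff_dvd_coeff] at hr
  have h1 := hr 1
  have h0 := hr 0
  simp only [primitiveLinear, coeff_sub, coeff_C_mul, coeff_X_one, coeff_C_succ, coeff_X_zero,
    coeff_C_zero, mul_zero, mul_one, zero_sub, sub_zero, dvd_neg] at h0 h1
  have hc : IsCoprime (q.num) (q.den : ℤ) :=
    Int.isCoprime_iff_gcd_eq_one.2 (by simpa [Int.gcd] using q.reduced)
  exact hc.isUnit_of_dvd' h0 h1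

/-- Gauss's lemma: the product is primitive, so divisibility over ℚ descends to ℤ. Comparing leading
coefficients then bounds the denominators. -/
theorem prod_primitiveLinear_dvd {P : ℤ[X]} (hP : P ≠ 0) (s : Finset ℚ)
    (hs : ∀ q ∈ s, (P.map (Int.castRingHom ℚ)).eval q = 0) :
    ∏ q ∈ s, primitiveLinear q ∣ P := by
  have hprim : (∏ q ∈ s, primitiveLinear q).IsPrimitive :=
    Finset.prod_induction _ _ (fun _ _ => IsPrimitive.mul) isPrimitive_one
      fun q _ => isPrimitive_primitiveLinear q
  rw [IsPrimitive.Int.dvd_iff_map_cast_dvd_map_cast _ _ hprim, Polynomial.map_prod]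
  simp only [map_primitiveLinear, Finset.prod_mul_distrib, ← map_prod]
  have hu : IsUnit (C (∏ q ∈ s, (q.den : ℚ))) := by
    rw [isUnit_C, isUnit_iff_ne_zero, Finset.prod_ne_zero_iff]
    exact fun q _ => by exact_mod_cast q.den_nz
  rw [hu.mul_left_dvd]
  have hP' : P.map (Int.castRingHom ℚ) ≠ 0 :=
    (Polynomial.map_ne_zero_iff (RingHom.injective_int _)).2 hP
  have := (Multiset.prod_X_sub_C_dvd_iff_le_roots hP' s.val).2
    ((Multiset.le_iff_subset s.nodup).2 fun q hq => (mem_roots hP').2 (hs q hq))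
  exact this

/-- The denominator of `q` divides the leading coefficient, so it is invertible modulo `p` and `q`
can be reduced. -/
theorem exists_root_zmod {P : ℤ[X]} (hP : P ≠ 0) {p : ℕ} [Fact p.Prime]
    (hp : ¬ (p : ℤ) ∣ P.leadingCoeff) {q : ℚ} (hq : (P.map (Int.castRingHom ℚ)).eval q = 0) :
    ∃ y : ZMod p, (P.map (Int.castRingHom (ZMod p))).eval y = 0 := by
  have h := prod_primitiveLinear_dvd hP {q} (by simpa using hq)
  rw [Finset.prod_singleton] at h
  obtain ⟨r, hr⟩ := h
  have hden : (q.den : ZMod p) ≠ 0 := by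
    intro h0
    apply hp
    rw [hr, leadingCoeff_mul, leadingCoeff_primitiveLinear]
    exact Dvd.dvd.mul_right (by exact_mod_cast (ZMod.natCast_eq_zero_iff _ _).1 h0) _
  refine ⟨q.num / q.den, ?_⟩
  rw [hr, Polynomial.map_mul, eval_mul]
  have : ((primitiveLinear q).map (Int.castRingHom (ZMod p))).eval (q.num / q.den : ZMod p) = 0 :=
      by
    rw [primitiveLinear, Polynomial.map_sub, Polynomial.map_mul, Polynomial.map_C,
      Polynomial.map_C, Polynomial.map_X, eval_sub, eval_mul, eval_C, eval_C, eval_X, eq_intCast,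
      eq_intCast, Int.cast_natCast, mul_div_cancel₀ _ hden, sub_self]
  rw [this, zero_mul]

/-- Only 1, 2 and 3 are integers in the interval; every other element has denominator at least 2. -/
theorem two_pow_le_prod_den (s : Finset ℚ) (hs : ∀ q ∈ s, 0 < q ∧ q < 4) :
    2 ^ (s.card - 3) ≤ ∏ q ∈ s, q.den := by
  have h1 : (s.filter fun q => q.den = 1) ⊆ {1, 2, 3} := by
    intro q hq
    rw [Finset.mem_filter] at hq
    obtain ⟨h0, h4⟩ := hs q hq.1
    have hq' := Rat.den_eq_one_iff _ |>.1 hq.2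
    rw [← hq'] at h0 h4 ⊢
    have h0' : 0 < q.num := by exact_mod_cast h0
    have h4' : q.num < 4 := by exact_mod_cast h4
    generalize q.num = k at h0' h4'
    interval_cases k <;> simp
  have h2 : (s.filter fun q => q.den = 1).card ≤ 3 := (Finset.card_le_card h1).trans (by decide)
  have h3 := Finset.card_filter_add_card_filter_not (s := s) (fun q : ℚ => q.den = 1)
  calc 2 ^ (s.card - 3) ≤ 2 ^ (s.filter fun q => ¬ q.den = 1).card :=
        Nat.pow_le_pow_right two_pos (by omega)
    _ ≤ ∏ q ∈ s.filter fun q => ¬ q.den = 1, q.den := by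
        refine Finset.pow_card_le_prod _ _ _ fun q hq => ?_
        have := (Finset.mem_filter.1 hq).2
        have := q.den_pos
        omega
    _ ≤ ∏ q ∈ s, q.den :=
        Finset.prod_le_prod_of_subset_of_one_le' (Finset.filter_subset _ _)
          fun q _ _ => q.den_pos

theorem card_rational_roots_gegenbauerSquare {n : ℕ} (hn : 2 ≤ n) (s : Finset ℚ)
    (hs : ∀ q ∈ s, 0 < q ∧ q < 4)
    (hr : ∀ q ∈ s, ((gegenbauerSquare n).map (Int.castRingHom ℚ)).eval q = 0) : s.card < n := by
  by_contra! hcard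
  have hP := gegenbauerSquare_ne_zero n
  -- At `n = 12` the comparison reads 512 ≤ 13 · 27 = 351, which fails; it still holds at `n = 11`.
  have hlt : n < 12 := by
    by_contra! hn12
    obtain ⟨r, hr⟩ := prod_primitiveLinear_dvd hP s hr
    have h := leadingCoeff_gegenbauerSquare n
    rw [hr, leadingCoeff_mul, leadingCoeff_prod] at h
    simp only [leadingCoeff_primitiveLinear] at h
    have h1 : (∏ q ∈ s, (q.den : ℤ)) ∣ ((n + 1) * (2 * n + 3) : ℤ) := by
      refine (IsUnit.dvd_mul_left (u := (-1 : ℤ) ^ n) ?_).1 ⟨_, h.symm⟩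
      exact isUnit_one.neg.pow n
    have h2 : ∏ q ∈ s, q.den ∣ (n + 1) * (2 * n + 3) := by exact_mod_cast h1
    have h3 := (two_pow_le_prod_den s hs).trans (Nat.le_of_dvd (by positivity) h2)
    have h4 : 2 ^ (n - 3) ≤ (n + 1) * (2 * n + 3) :=
      (Nat.pow_le_pow_right two_pos (by omega)).trans h3
    obtain ⟨k, rfl⟩ := Nat.exists_eq_add_of_le hn12
    rw [show 12 + k - 3 = k + 9 by omega] at h4
    refine absurd h4 (not_le.2 ?_)
    clear * -
    induction k with
    | zero => norm_num
    | succ k ih =>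
      rw [show k + 1 + 9 = k + 9 + 1 by ring, pow_succ]
      nlinarith
  obtain ⟨q, hq⟩ : s.Nonempty := Finset.card_pos.1 (by omega)
  have key : ∀ p : ℕ, p.Prime → ¬ (p : ℤ) ∣ (-1) ^ n * ((n + 1) * (2 * n + 3)) →
      ∃ y : ZMod p, ∑ l ∈ Finset.range (n + 1), (gegenbauerCoeff n l : ZMod p) * y ^ l = 0 := by
    intro p hp hpn
    have := Fact.mk hp
    rw [← leadingCoeff_gegenbauerSquare] at hpn
    simpa only [eval_map_gegenbauerSquare] using exists_root_zmod hP hpn (hr q hq)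
  -- Each prime is chosen not to divide (n + 1)(2n + 3) and so that the polynomial has no root
  -- modulo it; a single rational root is already contradictory.
  interval_cases n
  · exact absurd (key 11 (by norm_num) (by decide)) (by decide +kernel)
  · exact absurd (key 7 (by norm_num) (by decide)) (by decide +kernel)
  · exact absurd (key 29 (by norm_num) (by decide)) (by decide +kernel)
  · exact absurd (key 23 (by norm_num) (by decide)) (by decide +kernel)
  · exact absurd (key 19 (by norm_num) (by decide)) (by decide +kernel)
  · exact absurd (key 13 (by norm_num) (by decide)) (by decide +kernel)
  · exact absurd (key 2 (by norm_num) (by decide)) (by decide +kernel)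
  · exact absurd (key 43 (by norm_num) (by decide)) (by decide +kernel)
  · exact absurd (key 7 (by norm_num) (by decide)) (by decide +kernel)
  · exact absurd (key 11 (by norm_num) (by decide)) (by decide +kernel)

end

/-! # Non-existence -/

section

open Polynomial

/-- The Gegenbauer polynomial of degree `2 * n + 1` and parameter `3`, up to sign. -/
noncomputable def gegenbauerOdd (n : ℕ) : ℝ[X] :=
  X * ((gegenbauerSquare n).map (Int.castRingHom ℝ)).comp (4 * X ^ 2)

/-- Sonin's function of `gegenbauerOdd n` as a polynomial in `4 * x ^ 2`. -/
noncomputable def soninSquare (n : ℕ) : ℚ[X] :=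
  (1 - C (1 / 4) * X) * ((gegenbauerSquare n).map (Int.castRingHom ℚ) +
    2 * X * derivative ((gegenbauerSquare n).map (Int.castRingHom ℚ))) ^ 2 +
  C ((2 * n + 1) * (2 * n + 7) / 4 : ℚ) * X * ((gegenbauerSquare n).map (Int.castRingHom ℚ)) ^ 2

theorem eval_gegenbauerOdd (n : ℕ) (x : ℝ) :
    (gegenbauerOdd n).eval x =
      x * ((gegenbauerSquare n).map (Int.castRingHom ℝ)).eval (4 * x ^ 2) := by
  simp [gegenbauerOdd]

theorem natDegree_gegenbauerOdd (n : ℕ) : (gegenbauerOdd n).natDegree = 2 * n + 1 := by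
  have h4 : (4 * X ^ 2 : ℝ[X]).natDegree = 2 := natDegree_C_mul_X_pow 2 (4 : ℝ) (by norm_num)
  have h : (((gegenbauerSquare n).map (Int.castRingHom ℝ)).comp (4 * X ^ 2)).natDegree =
      2 * n := by
    rw [natDegree_comp, h4, natDegree_map_eq_of_injective (RingHom.injective_int _),
      natDegree_gegenbauerSquare, mul_comm]
  have h0 : ((gegenbauerSquare n).map (Int.castRingHom ℝ)).comp (4 * X ^ 2) ≠ 0 := by
    intro h0
    rw [Polynomial.comp_eq_zero_iff] at h0
    rcases h0 with h0 | ⟨-, h0⟩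
    · exact gegenbauerSquare_ne_zero n
        ((Polynomial.map_eq_zero_iff (RingHom.injective_int _)).1 h0)
    · rw [h0, natDegree_C] at h4
      omega
  rw [gegenbauerOdd, natDegree_X_mul h0, h]

theorem derivative_gegenbauerOdd (n : ℕ) :
    derivative (gegenbauerOdd n) =
      ((gegenbauerSquare n).map (Int.castRingHom ℝ)).comp (4 * X ^ 2) +
      8 * X ^ 2 * (derivative ((gegenbauerSquare n).map (Int.castRingHom ℝ))).comp (4 * X ^ 2) := by
  simp only [gegenbauerOdd, derivative_mul, derivative_comp, derivative_X, derivative_pow,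
    derivative_ofNat, Nat.cast_ofNat, map_ofNat]
  ring

theorem gegenbauerOp_gegenbauerOdd (n : ℕ) :
    gegenbauerOp 7 (gegenbauerOdd n) =
      C (-(((2 * n + 1 : ℕ) : ℝ) * ((2 * n + 1 : ℕ) + 7 - 1))) * gegenbauerOdd n := by
  have h := congrArg (fun q => (q.map (Int.castRingHom ℝ)).comp (4 * X ^ 2))
    (gegenbauerSquare_ode n)
  simp only [Polynomial.map_add, Polynomial.map_sub, Polynomial.map_mul, Polynomial.map_pow,
    Polynomial.map_X, Polynomial.map_C, Polynomial.map_ofNat, Polynomial.map_zero, add_comp,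
    sub_comp, mul_comp, pow_comp, X_comp, C_comp, zero_comp, ofNat_comp, ← derivative_map] at h
  have hC : (C (-(((2 * n + 1 : ℕ) : ℝ) * ((2 * n + 1 : ℕ) + 7 - 1))) : ℝ[X]) =
      -(4 * C (Int.castRingHom ℝ (n * (n + 4))) + 7) := by
    rw [← C_ofNat, ← C_ofNat, ← C_mul, ← C_add, ← C_neg]
    congr 1
    simp
    ring
  rw [gegenbauerOp, derivative_gegenbauerOdd, hC, gegenbauerOdd]
  simp only [derivative_mul, derivative_comp, derivative_X, derivative_pow, derivative_add,
    derivative_ofNat, Nat.cast_ofNat, map_ofNat]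
  linear_combination (4 * X) * h

theorem eval_sonin_gegenbauerOdd (n : ℕ) (x : ℝ) :
    (sonin 7 (2 * n + 1) (gegenbauerOdd n)).eval x =
      ((soninSquare n).map (algebraMap ℚ ℝ)).eval (4 * x ^ 2) := by
  have h : ((gegenbauerSquare n).map (Int.castRingHom ℚ)).map (algebraMap ℚ ℝ) =
      (gegenbauerSquare n).map (Int.castRingHom ℝ) := by
    rw [Polynomial.map_map, RingHom.ext_int ((algebraMap ℚ ℝ).comp _) (Int.castRingHom ℝ)]
  rw [sonin, derivative_gegenbauerOdd, gegenbauerOdd, soninSquare]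
  simp only [Polynomial.map_add, Polynomial.map_sub, Polynomial.map_mul, Polynomial.map_pow,
    Polynomial.map_X, Polynomial.map_C, Polynomial.map_ofNat, Polynomial.map_one,
    ← derivative_map, h, eval_add, eval_sub, eval_mul, eval_pow, eval_X, eval_C, eval_comp,
    eval_ofNat, eval_one]
  simp
  ring

theorem eval_zero_gegenbauerSquare_ne_zero (n : ℕ) :
    ((gegenbauerSquare n).map (Int.castRingHom ℝ)).eval 0 ≠ 0 := by
  rw [← coeff_zero_eq_eval_zero, coeff_map, coeff_gegenbauerSquare, gegenbauerCoeff]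
  have := Nat.choose_pos (n := n + 3) (k := 3) (by omega)
  simp [this.ne']

theorem derivative_gegenbauerOdd_ne_zero (n : ℕ) : derivative (gegenbauerOdd n) ≠ 0 := by
  intro h
  have h1 := congrArg (eval 0) h
  rw [derivative_gegenbauerOdd] at h1
  exact eval_zero_gegenbauerSquare_ne_zero n (by simpa using h1)

theorem sonin_gegenbauerOdd_abs (n : ℕ) (x : ℝ) :
    (sonin 7 (2 * n + 1) (gegenbauerOdd n)).eval |x| =
      (sonin 7 (2 * n + 1) (gegenbauerOdd n)).eval x := by
  rw [eval_sonin_gegenbauerOdd, eval_sonin_gegenbauerOdd, sq_abs]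

theorem sonin_gegenbauerOdd_lt (n : ℕ) {a b : ℝ} (h : |a| < |b|) :
    (sonin 7 (2 * n + 1) (gegenbauerOdd n)).eval a <
      (sonin 7 (2 * n + 1) (gegenbauerOdd n)).eval b := by
  rw [← sonin_gegenbauerOdd_abs, ← sonin_gegenbauerOdd_abs n b]
  exact sonin_eval_lt (by norm_num) (derivative_gegenbauerOdd_ne_zero n)
    (gegenbauerOp_gegenbauerOdd n) (abs_nonneg a) h

theorem sonin_gegenbauerOdd_zero_pos (n : ℕ) :
    0 < (sonin 7 (2 * n + 1) (gegenbauerOdd n)).eval 0 := by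
  have := eval_zero_gegenbauerSquare_ne_zero n
  rw [sonin, derivative_gegenbauerOdd]
  have h : 0 < ((gegenbauerSquare n).map (Int.castRingHom ℝ)).eval 0 ^ 2 := by positivity
  simpa [gegenbauerOdd] using h

theorem sonin_gegenbauerOdd_pos (n : ℕ) (x : ℝ) :
    0 < (sonin 7 (2 * n + 1) (gegenbauerOdd n)).eval x := by
  rcases eq_or_ne x 0 with rfl | hx
  · exact sonin_gegenbauerOdd_zero_pos n
  · exact (sonin_gegenbauerOdd_zero_pos n).trans (sonin_gegenbauerOdd_lt n (by simpa using hx))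

/-- A root of a rational polynomial split over `ℝ` is rational if it is determined by a rational
value of another rational polynomial. -/
theorem exists_rat_of_unique_root {P R : ℚ[X]} (hP : P ≠ 0)
    (hsplit : (P.map (algebraMap ℚ ℝ)).Splits) {y : ℝ} {r : ℚ}
    (hy : aeval y P = 0) (hr : aeval y R = r)
    (huniq : ∀ y' : ℝ, aeval y' P = 0 → aeval y' R = r → y' = y) : ∃ q : ℚ, (q : ℝ) = y := by
  have hint : IsIntegral ℚ y := IsAlgebraic.isIntegral ⟨P, hP, hy⟩
  have h1 : minpoly ℚ y ∣ P := minpoly.dvd ℚ y hy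
  have h2 : minpoly ℚ y ∣ R - C r := minpoly.dvd ℚ y (by simp [hr])
  have hsub : ∀ y' : ℝ, aeval y' (minpoly ℚ y) = 0 → y' = y := by
    intro y' h'
    refine huniq y' (aeval_eq_zero_of_dvd_aeval_eq_zero h1 h') ?_
    simpa [sub_eq_zero] using aeval_eq_zero_of_dvd_aeval_eq_zero h2 h'
  -- The minimal polynomial is separable and splits over ℝ, so it has as many real roots as its
  -- degree; all of them equal `y`.
  have hcard := card_rootSet_eq_natDegree (K := ℝ) (minpoly.irreducible hint).separable
    (hsplit.of_dvd ((Polynomial.map_ne_zero_iff (algebraMap ℚ ℝ).injective).2 hP)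
      (Polynomial.map_dvd _ h1))
  have hle : Fintype.card ((minpoly ℚ y).rootSet ℝ) ≤ 1 := by
    rw [Fintype.card_le_one_iff]
    intro a b
    have ha := hsub a (mem_rootSet.1 a.2).2
    have hb := hsub b (mem_rootSet.1 b.2).2
    exact Subtype.ext (ha.trans hb.symm)
  have hdeg : (minpoly ℚ y).natDegree = 1 :=
    le_antisymm (hcard ▸ hle) (minpoly.natDegree_pos hint)
  obtain ⟨q, hq⟩ := minpoly.natDegree_eq_one_iff.1 hdeg
  exact ⟨q, by simpa using hq⟩

/-! ### From designs to quadrature on the line. -/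

/-- Integration over the sphere of polynomials in the inner product with `z`. -/
noncomputable def zonalFunctional {d : ℕ} (z : UnitSphere d) : ℝ[X] →ₗ[ℝ] ℝ :=
  (basisMonomials ℝ).constr ℝ (sphereMoment z)

theorem zonalFunctional_X_pow {d : ℕ} (z : UnitSphere d) (k : ℕ) :
    zonalFunctional z (X ^ k) = sphereMoment z k := by
  have h : basisMonomials ℝ k = X ^ k := by
    rw [coe_basisMonomials]
    exact monomial_one_right_eq_X_pow k
  rw [← h, zonalFunctional, Module.Basis.constr_basis]

theorem isGegenbauerFunctional_zonalFunctional {d : ℕ} [NeZero d] (z : UnitSphere d) :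
    IsGegenbauerFunctional (d - 1) (zonalFunctional z) where
  one := by rw [← pow_one X, zonalFunctional_X_pow, sphereMoment_of_odd z odd_one]
  add_two k := by
    rw [zonalFunctional_X_pow, zonalFunctional_X_pow, ← sphereMoment_add_two]
    ring

/-- The proportion of the points of `Y` whose inner product with `z` is `a`. -/
noncomputable def innerWeight {d : ℕ} (z : UnitSphere d) (Y : Finset (UnitSphere d)) (a : ℝ) : ℚ :=
  ((Y.filter fun x : UnitSphere d =>
    inner ℝ (z : EuclideanSpace ℝ (Fin d)) (x : EuclideanSpace ℝ (Fin d)) = a).card : ℚ) / Y.card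

theorem innerWeight_pos {d : ℕ} {z : UnitSphere d} {Y : Finset (UnitSphere d)} {a : ℝ}
    (ha : a ∈ innerProducts z Y) : 0 < innerWeight z Y a := by
  obtain ⟨x, hx, hxa⟩ := Finset.mem_image.1 ha
  have h1 : 0 < Y.card := Finset.card_pos.2 ⟨x, hx⟩
  have h2 : 0 < (Y.filter fun x : UnitSphere d =>
      inner ℝ (z : EuclideanSpace ℝ (Fin d)) (x : EuclideanSpace ℝ (Fin d)) = a).card :=
    Finset.card_pos.2 ⟨x, Finset.mem_filter.2 ⟨hx, hxa⟩⟩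
  unfold innerWeight
  positivity

theorem IsSphericalDesign.average_inner_pow {d t : ℕ} {Y : Finset (UnitSphere d)}
    (hY : IsSphericalDesign t Y) (z : UnitSphere d) {k : ℕ} (hk : k ≤ t) :
    (1 / (Y.card : ℝ)) * ∑ x ∈ Y,
      inner ℝ (z : EuclideanSpace ℝ (Fin d)) (x : EuclideanSpace ℝ (Fin d)) ^ k =
        sphereMoment z k := by
  let f : MvPolynomial (Fin d) ℝ :=
    (∑ i, MvPolynomial.C ((z : EuclideanSpace ℝ (Fin d)) i) * MvPolynomial.X i) ^ k
  have hf : f.totalDegree ≤ t := by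
    refine (MvPolynomial.totalDegree_pow _ _).trans (le_trans ?_ hk)
    refine (Nat.mul_le_mul_left k (MvPolynomial.totalDegree_finsetSum_le (d := 1) fun i _ =>
        ?_)).trans
      (by simp)
    exact (MvPolynomial.totalDegree_mul _ _).trans (by simp)
  have he : ∀ x : UnitSphere d, polyOnSphere f x =
      inner ℝ (z : EuclideanSpace ℝ (Fin d)) (x : EuclideanSpace ℝ (Fin d)) ^ k := by
    intro x
    simp [polyOnSphere, f, PiLp.inner_apply, mul_comm]
  have h := hY.2 f hf
  simp only [he] at h
  exact h

/-- A polynomial in the inner product with `z` has the same degree bound as a polynomial on the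
sphere. Grouping the points of `Y` by that inner product produces rational weights. -/
theorem IsSphericalDesign.quadrature {d t : ℕ} {Y : Finset (UnitSphere d)}
    (hY : IsSphericalDesign t Y) (z : UnitSphere d) {f : ℝ[X]} (hf : f.natDegree ≤ t) :
    zonalFunctional z f = ∑ a ∈ innerProducts z Y, (innerWeight z Y a : ℝ) * f.eval a := by
  have h1 : zonalFunctional z f = (1 / (Y.card : ℝ)) * ∑ x ∈ Y,
      f.eval (inner ℝ (z : EuclideanSpace ℝ (Fin d)) (x : EuclideanSpace ℝ (Fin d))) := by
    conv_lhs => rw [f.as_sum_range_C_mul_X_pow]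
    simp only [eval_eq_sum_range, ← smul_eq_C_mul, map_sum, map_smul, zonalFunctional_X_pow]
    rw [Finset.sum_comm, Finset.mul_sum]
    refine Finset.sum_congr rfl fun k hk => ?_
    rw [← hY.average_inner_pow z (by have := Finset.mem_range.1 hk; omega), ← Finset.mul_sum,
      smul_eq_mul]
    ring
  rw [h1, ← Finset.sum_fiberwise_of_maps_to (t := innerProducts z Y)
    (g := fun x : UnitSphere d => inner ℝ (z : EuclideanSpace ℝ (Fin d))
        (x : EuclideanSpace ℝ (Fin d)))
    (fun x hx => Finset.mem_image_of_mem _ hx), Finset.mul_sum]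
  refine Finset.sum_congr rfl fun a _ => ?_
  rw [Finset.sum_congr rfl (g := fun _ => f.eval a)
    fun x hx => by rw [(Finset.mem_filter.1 hx).2]]
  simp [innerWeight]
  ring

theorem le_one_of_isStiff {n : ℕ} {Y : Finset (UnitSphere 8)} (hY : IsStiff (2 * n + 1) Y) :
    n ≤ 1 := by
  obtain ⟨-, hdes, z, hz⟩ := hY
  by_contra! hn
  set A := innerProducts z Y
  have hL := isGegenbauerFunctional_zonalFunctional z
  rw [show ((8 : ℕ) : ℝ) - 1 = 7 by norm_num] at hL
  have hA : A.Nonempty := hdes.1.image _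
  obtain ⟨hcard, hroots, K, hK⟩ := gauss_quadrature hL (by norm_num) (natDegree_gegenbauerOdd n)
    (gegenbauerOp_gegenbauerOdd n) (sonin_gegenbauerOdd_pos n) hA hz
    (w := fun a => innerWeight z Y a) (fun a ha => by exact_mod_cast innerWeight_pos ha)
    (fun f hf => hdes.quadrature z hf)
  have h0A : (0 : ℝ) ∈ A := (hroots 0).1 (by simp [eval_gegenbauerOdd])
  set P : ℚ[X] := (gegenbauerSquare n).map (Int.castRingHom ℚ)
  have hPmap : P.map (algebraMap ℚ ℝ) = (gegenbauerSquare n).map (Int.castRingHom ℝ) := by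
    rw [Polynomial.map_map, RingHom.ext_int ((algebraMap ℚ ℝ).comp _) (Int.castRingHom ℝ)]
  have hP0 : P ≠ 0 :=
    (Polynomial.map_ne_zero_iff (RingHom.injective_int _)).2 (gegenbauerSquare_ne_zero n)
  have haeval : ∀ y : ℝ, aeval y P = ((gegenbauerSquare n).map (Int.castRingHom ℝ)).eval y := by
    intro y
    rw [aeval_def, eval₂_eq_eval_map, hPmap]
  set T := (A.erase 0).image fun a => 4 * a ^ 2
  have hT : ∀ y ∈ T, aeval y P = 0 := by
    intro y hy
    obtain ⟨a, ha, rfl⟩ := Finset.mem_image.1 hy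
    have h := (hroots a).2 (Finset.mem_of_mem_erase ha)
    rw [eval_gegenbauerOdd] at h
    rw [haeval]
    exact (mul_eq_zero.1 h).resolve_left (Finset.ne_of_mem_erase ha)
  -- The `2n` nonzero nodes are mapped at most two to one. Hence `T` exhausts the roots of `P`, and
  -- the splitting of `P` over ℝ comes for free.
  have hTcard : n ≤ T.card := by
    have h := Finset.card_le_mul_card_image (f := fun a : ℝ => 4 * a ^ 2) (A.erase 0) 2 (by
      intro y hy
      obtain ⟨a, ha, rfl⟩ := Finset.mem_image.1 hy
      refine (Finset.card_le_card (t := {a, -a}) fun b hb => ?_).trans Finset.card_le_two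
      have := (Finset.mem_filter.1 hb).2
      rw [Finset.mem_insert, Finset.mem_singleton, ← sq_eq_sq_iff_eq_or_eq_neg]
      linarith)
    rw [Finset.card_erase_of_mem h0A, hcard] at h
    change 2 * n + 1 - 1 ≤ 2 * T.card at h
    omega
  have hne := (Polynomial.map_ne_zero_iff (algebraMap ℚ ℝ).injective).2 hP0
  have hd : (P.map (algebraMap ℚ ℝ)).natDegree = n := by
    rw [hPmap, natDegree_map_eq_of_injective (RingHom.injective_int _), natDegree_gegenbauerSquare]
  have hmem : ∀ y : ℝ, y ∈ (P.map (algebraMap ℚ ℝ)).roots.toFinset ↔ aeval y P = 0 := by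
    intro y
    rw [Multiset.mem_toFinset, mem_roots hne, IsRoot.def, hPmap, ← haeval]
  have hroot_card : (P.map (algebraMap ℚ ℝ)).roots.toFinset.card ≤
      (P.map (algebraMap ℚ ℝ)).roots.card := Multiset.toFinset_card_le _
  have hroot_le := card_roots' (P.map (algebraMap ℚ ℝ))
  rw [hd] at hroot_le
  have hTeq : T = (P.map (algebraMap ℚ ℝ)).roots.toFinset :=
    Finset.eq_of_subset_of_card_le (fun y hy => (hmem y).2 (hT y hy)) (by omega)
  have hsplit : (P.map (algebraMap ℚ ℝ)).Splits := by
    rw [splits_iff_card_roots, hd]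
    rw [← hTeq] at hroot_card
    omega
  have hSeval : ∀ a : ℝ, aeval (4 * a ^ 2) (soninSquare n) =
      (sonin 7 (2 * n + 1) (gegenbauerOdd n)).eval a := by
    intro a
    rw [eval_sonin_gegenbauerOdd, aeval_def, eval₂_eq_eval_map]
  have hrat : ∀ y ∈ T, ∃ q : ℚ, (q : ℝ) = y := by
    intro y hy
    have hy0 := hT y hy
    obtain ⟨a, ha, rfl⟩ := Finset.mem_image.1 hy
    have haA := Finset.mem_of_mem_erase ha
    have hwa : (innerWeight z Y a : ℝ) ≠ 0 := by exact_mod_cast (innerWeight_pos haA).ne'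
    -- Comparison with the node 0: weight times Sonin's function is the same at both, and everything
    -- except the value at `a` is visibly rational.
    have hval : aeval (4 * a ^ 2) (soninSquare n) =
        ((innerWeight z Y 0 * (soninSquare n).eval 0 / innerWeight z Y a : ℚ) : ℝ) := by
      have h1 := (hK a haA).trans (hK 0 h0A).symm
      have h2 : (sonin 7 (2 * n + 1) (gegenbauerOdd n)).eval 0 =
          (((soninSquare n).eval 0 : ℚ) : ℝ) := by
        rw [← hSeval]
        simpa using aeval_algebraMap_apply ℝ (0 : ℚ) (soninSquare n)
      rw [hSeval]
      push_cast
      rw [eq_div_iff hwa, ← h2, ← h1, mul_comm]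
    refine exists_rat_of_unique_root hP0 hsplit hy0 hval fun y' hy' hr' => ?_
    rw [← hmem, ← hTeq] at hy'
    obtain ⟨b, -, rfl⟩ := Finset.mem_image.1 hy'
    rw [← hval, hSeval, hSeval] at hr'
    have hab : |b| = |a| := le_antisymm
      (not_lt.1 fun h => (sonin_gegenbauerOdd_lt n h).ne hr'.symm)
      (not_lt.1 fun h => (sonin_gegenbauerOdd_lt n h).ne hr')
    rw [← sq_abs b, hab, sq_abs]
  choose g hg using fun y : T => hrat y y.2
  have hginj : Function.Injective g := fun a b h => Subtype.ext (by rw [← hg a, ← hg b, h])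
  refine absurd (card_rational_roots_gegenbauerSquare hn (Finset.univ.image g) ?_ ?_) ?_
  · intro q hq
    obtain ⟨y, -, rfl⟩ := Finset.mem_image.1 hq
    obtain ⟨a, ha, hya⟩ := Finset.mem_image.1 y.2
    have hpos := sonin_gegenbauerOdd_pos n a
    rw [sonin, eval_add, eval_mul, eval_mul, eval_pow, eval_pow,
      (hroots a).2 (Finset.mem_of_mem_erase ha)] at hpos
    -- At a node Sonin's function reduces to (1 - a²)p'(a)², so its positivity places the node
    -- inside (-1, 1).
    have hlt : 0 < 1 - a ^ 2 := by
      refine pos_of_mul_pos_left (b := (derivative (gegenbauerOdd n)).eval a ^ 2) ?_ (sq_nonneg _)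
      simpa using hpos
    have ha0 : a ≠ 0 := Finset.ne_of_mem_erase ha
    have h1 : (0 : ℝ) < g y := by
      rw [hg, ← hya]
      positivity
    have h2 : (g y : ℝ) < 4 := by
      rw [hg, ← hya]
      linarith
    exact ⟨by exact_mod_cast h1, by exact_mod_cast h2⟩
  · intro q hq
    obtain ⟨y, -, rfl⟩ := Finset.mem_image.1 hq
    have h := hT y y.2
    rw [← hg y] at h
    have h' : aeval (algebraMap ℚ ℝ (g y)) P = 0 := by simpa using h
    rw [aeval_algebraMap_apply] at h'
    simpa [P] using h'
  · rw [Finset.card_image_of_injective _ hginj, Finset.card_univ, Fintype.card_coe]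
    exact not_lt.2 hTcard

end

/-! # Existence -/

section

open MeasureTheory

/-- The average over the sphere of the monomial with exponents `a`. -/
noncomputable def monomialAverage {d : ℕ} (a : Fin d → ℕ) : ℝ :=
  sphereAverage fun x : UnitSphere d => ∏ i, (x : EuclideanSpace ℝ (Fin d)) i ^ a i

theorem monomialAverage_zero {d : ℕ} [NeZero d] : monomialAverage (0 : Fin d → ℕ) = 1 := by
  have := (surfaceMeasure_real_univ_pos (d := d)).ne'
  simp [monomialAverage, sphereAverage, this]

theorem monomialAverage_of_odd {d : ℕ} [NeZero d] {a : Fin d → ℕ} {i : Fin d} (hi : Odd (a i)) :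
    monomialAverage a = 0 := by
  have h := integral_sphere_monomial a
  rw [Finset.prod_eq_zero (Finset.mem_univ i) (gaussianMoment_of_odd hi), mul_eq_zero,
    or_iff_left (halfGaussianMoment_pos _).ne'] at h
  rw [monomialAverage, sphereAverage, h, mul_zero]

/-- Raising one exponent by 2 multiplies the Gaussian product by (a_i + 1)/2 and the radial factor
by (∑ a_j + d)/2. -/
theorem monomialAverage_add_single {d : ℕ} [NeZero d] (a : Fin d → ℕ) (i : Fin d) :
    (∑ j, (a j : ℝ) + d) * monomialAverage (a + Pi.single i 2) =
      (a i + 1) * monomialAverage a := by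
  have h0 := integral_sphere_monomial a
  have h1 := integral_sphere_monomial (a + Pi.single i 2)
  have hd : 1 ≤ d := NeZero.one_le
  have hsum : ∑ j, (a + Pi.single i 2 : Fin d → ℕ) j + (d - 1) = ∑ j, a j + (d - 1) + 2 := by
    simp only [Pi.add_apply, Finset.sum_add_distrib, Finset.sum_pi_single', Finset.mem_univ,
        if_true]
    ring
  have hprod : ∏ j, gaussianMoment ((a + Pi.single i 2 : Fin d → ℕ) j) =
      (a i + 1) / 2 * ∏ j, gaussianMoment (a j) := by
    rw [← Finset.mul_prod_erase _ _ (Finset.mem_univ i),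
      ← Finset.mul_prod_erase _ (fun j => gaussianMoment (a j)) (Finset.mem_univ i), ← mul_assoc,
      ← gaussianMoment_add_two]
    congr 1
    · simp
    · refine Finset.prod_congr rfl fun j hj => ?_
      simp [Finset.ne_of_mem_erase hj]
  rw [hsum, halfGaussianMoment_add_two, hprod] at h1
  push_cast [hd] at h1
  have hp := (halfGaussianMoment_pos (∑ j, a j + (d - 1))).ne'
  rw [monomialAverage, monomialAverage, sphereAverage, sphereAverage, mul_left_comm,
    mul_left_comm (_ + 1)]
  congr 1
  apply mul_right_cancel₀ hp
  linear_combination 2 * h1 - (a i + 1 : ℝ) * h0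

theorem isSphericalDesign_of_monomials {d t : ℕ} [NeZero d] {Y : Finset (UnitSphere d)}
    (hY : Y.Nonempty)
    (h : ∀ a : Fin d → ℕ, ∑ i, a i ≤ t →
      ∑ x ∈ Y, ∏ i, (x : EuclideanSpace ℝ (Fin d)) i ^ a i = Y.card * monomialAverage a) :
    IsSphericalDesign t Y := by
  refine ⟨hY, fun f hf => ?_⟩
  have hfin : IsFiniteMeasure (surfaceMeasure d) := by
    unfold surfaceMeasure
    infer_instance
  have hint : ∀ a : Fin d → ℕ, Integrable
      (fun x : UnitSphere d => ∏ i, (x : EuclideanSpace ℝ (Fin d)) i ^ a i) (surfaceMeasure d) :=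
    fun a => Continuous.integrable_of_hasCompactSupport (by fun_prop)
      (HasCompactSupport.of_compactSpace _)
  have hcard : (Y.card : ℝ) ≠ 0 := by exact_mod_cast hY.card_pos.ne'
  simp only [polyOnSphere, MvPolynomial.eval_eq']
  rw [integral_finsetSum _ fun (a : Fin d →₀ ℕ) _ => (hint a).const_mul (f.coeff a),
      Finset.sum_comm, Finset.mul_sum,
    Finset.mul_sum]
  refine Finset.sum_congr rfl fun a ha => ?_
  have hat : ∑ i, a i ≤ t := by
    refine le_trans ?_ ((MvPolynomial.le_totalDegree ha).trans hf)
    rw [Finsupp.sum_fintype _ _ fun _ => rfl]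
  have := h a hat
  rw [monomialAverage, sphereAverage] at this
  rw [integral_const_mul, ← Finset.mul_sum, this]
  field_simp

/-! ### Point sets invariant under sign changes. -/

/-- The signed square root of `t / N`. -/
noncomputable def signedSqrt (N : ℕ) (t : ℤ) : ℝ := t.sign * √(t.natAbs / N)

theorem signedSqrt_neg (N : ℕ) (t : ℤ) : signedSqrt N (-t) = -signedSqrt N t := by
  simp [signedSqrt]

theorem signedSqrt_sq (N : ℕ) (t : ℤ) : signedSqrt N t ^ 2 = t.natAbs / N := by
  rw [signedSqrt, mul_pow, Real.sq_sqrt (by positivity)]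
  rcases eq_or_ne t 0 with rfl | ht
  · simp
  · have : t.sign ^ 2 = 1 := by
      rcases ht.lt_or_gt with h | h
      · simp [Int.sign_eq_neg_one_of_neg h]
      · simp [Int.sign_eq_one_of_pos h]
    rw [show (t.sign : ℝ) ^ 2 = ((t.sign ^ 2 : ℤ) : ℝ) by push_cast; rfl, this]
    simp

theorem signedSqrt_injective {N : ℕ} (hN : 0 < N) : Function.Injective (signedSqrt N) := by
  have hN' : (0 : ℝ) < N := by exact_mod_cast hN
  intro s t h
  have h1 : s.natAbs = t.natAbs := by
    have h2 := signedSqrt_sq N s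
    rw [h, signedSqrt_sq, div_left_inj' hN'.ne'] at h2
    exact_mod_cast h2.symm
  rcases Int.natAbs_eq_natAbs_iff.1 h1 with h2 | h2
  · exact h2
  · rcases eq_or_ne t 0 with rfl | ht
    · simpa using h2
    · rw [h2, signedSqrt_neg] at h
      have h3 : signedSqrt N t = 0 := by linarith
      have h4 := signedSqrt_sq N t
      rw [h3, zero_pow two_ne_zero, eq_comm, div_eq_zero_iff, or_iff_left hN'.ne'] at h4
      exact absurd (Int.natAbs_eq_zero.1 (by exact_mod_cast h4)) ht

/-- The integer vectors whose vector of absolute values belongs to `Q`. -/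
def signedVectors {d : ℕ} (Q : Finset (Fin d → ℕ)) : Finset (Fin d → ℤ) :=
  Q.biUnion fun q => Fintype.piFinset fun i => {(q i : ℤ), -(q i : ℤ)}

theorem mem_signedVectors {d : ℕ} {Q : Finset (Fin d → ℕ)} {s : Fin d → ℤ} :
    s ∈ signedVectors Q ↔ (fun i => (s i).natAbs) ∈ Q := by
  simp only [signedVectors, Finset.mem_biUnion, Fintype.mem_piFinset, Finset.mem_insert,
    Finset.mem_singleton, ← Int.natAbs_eq_iff]
  constructor
  · rintro ⟨q, hq, h⟩
    rwa [funext h]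
  · exact fun h => ⟨_, h, fun _ => rfl⟩

/-- The points of the sphere with coordinates `± √(q i / N)`, for `q ∈ Q`. -/
noncomputable def signedPoints {d : ℕ} (N : ℕ) (Q : Finset (Fin d → ℕ)) :
    Finset (UnitSphere d) :=
  open scoped Classical in
  Finset.subtype (fun x : EuclideanSpace ℝ (Fin d) => x ∈ Metric.sphere
      (0 : EuclideanSpace ℝ (Fin d)) 1)
    ((signedVectors Q).image fun s => WithLp.toLp 2 fun i => signedSqrt N (s i))

/-- The number of sign changes of a vector of absolute values `q`. -/
def signCount {d : ℕ} (q : Fin d → ℕ) : ℕ := ∏ i, if q i = 0 then 1 else 2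

section

variable {d N : ℕ} {Q : Finset (Fin d → ℕ)}

theorem toLp_signedSqrt_mem_sphere (hN : 0 < N) (hQ : ∀ q ∈ Q, ∑ i, q i = N) {s : Fin d → ℤ}
    (hs : s ∈ signedVectors Q) :
    WithLp.toLp 2 (fun i => signedSqrt N (s i)) ∈
      Metric.sphere (0 : EuclideanSpace ℝ (Fin d)) 1 := by
  have hN' : (N : ℝ) ≠ 0 := by exact_mod_cast hN.ne'
  rw [mem_sphere_zero_iff_norm, ← sq_eq_sq₀ (norm_nonneg _) zero_le_one, EuclideanSpace.norm_sq_eq]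
  simp only [Real.norm_eq_abs, sq_abs, signedSqrt_sq]
  rw [← Finset.sum_div, one_pow, div_eq_one_iff_eq hN']
  exact_mod_cast hQ _ (mem_signedVectors.1 hs)

theorem exists_of_mem_signedPoints {x : UnitSphere d} (hx : x ∈ signedPoints N Q) :
    ∃ s ∈ signedVectors Q, ∀ i, (x : EuclideanSpace ℝ (Fin d)) i = signedSqrt N (s i) := by
  classical
  rw [signedPoints, Finset.mem_subtype, Finset.mem_image] at hx
  obtain ⟨s, hs, h⟩ := hx
  exact ⟨s, hs, fun i => by rw [← h]⟩

theorem sum_signedSqrt_pow_even (n b : ℕ) :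
    ∑ t ∈ ({(n : ℤ), -(n : ℤ)} : Finset ℤ), signedSqrt N t ^ (2 * b) =
      (if n = 0 then 1 else 2 : ℕ) * ((n : ℝ) / N) ^ b := by
  rcases eq_or_ne n 0 with rfl | hn
  · simp [pow_mul, signedSqrt_sq]
  · rw [Finset.sum_pair (by omega)]
    simp only [pow_mul, signedSqrt_sq, Int.natAbs_neg, Int.natAbs_natCast, if_neg hn]
    push_cast
    ring

theorem sum_signedSqrt_pow_odd (n : ℕ) {k : ℕ} (hk : Odd k) :
    ∑ t ∈ ({(n : ℤ), -(n : ℤ)} : Finset ℤ), signedSqrt N t ^ k = 0 := by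
  rcases eq_or_ne n 0 with rfl | hn
  · simp [signedSqrt, hk.pos.ne']
  · rw [Finset.sum_pair (by omega), signedSqrt_neg, hk.neg_pow, add_neg_cancel]

/-- Absolute values determine the row, so different rows give disjoint sets of points; within a row
the signs are independent and the sum factors. For a zero coordinate the pair of signs collapses to
one element. -/
theorem sum_signedPoints (hN : 0 < N) (hQ : ∀ q ∈ Q, ∑ i, q i = N) (a : Fin d → ℕ) :
    ∑ x ∈ signedPoints N Q, ∏ i, (x : EuclideanSpace ℝ (Fin d)) i ^ a i =
      ∑ q ∈ Q, ∏ i, ∑ t ∈ ({(q i : ℤ), -(q i : ℤ)} : Finset ℤ), signedSqrt N t ^ a i := by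
  classical
  rw [signedPoints, Finset.sum_subtype_of_mem
    (fun x : EuclideanSpace ℝ (Fin d) => ∏ i, x i ^ a i), Finset.sum_image, signedVectors,
    Finset.sum_biUnion]
  · exact Finset.sum_congr rfl fun q _ =>
      (Finset.prod_univ_sum (fun i => ({(q i : ℤ), -(q i : ℤ)} : Finset ℤ))
        fun i t => signedSqrt N t ^ a i).symm
  · intro q _ q' _ hne
    rw [Function.onFun, Finset.disjoint_left]
    intro s hs hs'
    rw [Fintype.mem_piFinset] at hs hs'
    refine hne (funext fun i => ?_)
    have h1 := hs i
    have h2 := hs' i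
    simp only [Finset.mem_insert, Finset.mem_singleton] at h1 h2
    omega
  · intro s _ s' _ h
    funext i
    exact signedSqrt_injective hN (congrArg (fun x : EuclideanSpace ℝ (Fin d) => x i) h)
  · intro x hx
    obtain ⟨s, hs, rfl⟩ := Finset.mem_image.1 hx
    exact toLp_signedSqrt_mem_sphere hN hQ hs

theorem sum_signedPoints_even (hN : 0 < N) (hQ : ∀ q ∈ Q, ∑ i, q i = N) (b : Fin d → ℕ) :
    ∑ x ∈ signedPoints N Q, ∏ i, (x : EuclideanSpace ℝ (Fin d)) i ^ (2 * b i) =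
      ∑ q ∈ Q, signCount q * ∏ i, ((q i : ℝ) / N) ^ b i := by
  rw [sum_signedPoints hN hQ fun i => 2 * b i]
  refine Finset.sum_congr rfl fun q _ => ?_
  simp only [sum_signedSqrt_pow_even, Finset.prod_mul_distrib, signCount, Nat.cast_prod]

theorem card_signedPoints (hN : 0 < N) (hQ : ∀ q ∈ Q, ∑ i, q i = N) :
    (signedPoints N Q).card = ∑ q ∈ Q, signCount q := by
  have h := sum_signedPoints_even hN hQ 0
  simp only [Pi.zero_apply, mul_zero, pow_zero, Finset.prod_const_one, Finset.sum_const,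
    nsmul_eq_mul, mul_one] at h
  exact_mod_cast h

/-- A criterion for `signedPoints N Q` to be a design, in terms of its even moments. -/
theorem isSphericalDesign_signedPoints [NeZero d] {t : ℕ} (hN : 0 < N)
    (hQ : ∀ q ∈ Q, ∑ i, q i = N) (hne : Q.Nonempty)
    (h : ∀ b : Fin d → ℕ, 2 * ∑ i, b i ≤ t →
      ∑ q ∈ Q, signCount q * ∏ i, ((q i : ℝ) / N) ^ b i =
        (∑ q ∈ Q, signCount q : ℕ) * monomialAverage (fun i => 2 * b i)) :
    IsSphericalDesign t (signedPoints N Q) := by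
  refine isSphericalDesign_of_monomials (Finset.card_pos.1 ?_) fun a ha => ?_
  · rw [card_signedPoints hN hQ]
    exact Finset.sum_pos
      (fun q _ => Finset.prod_pos fun i _ => by split_ifs <;> norm_num) hne
  · by_cases hodd : ∃ i, Odd (a i)
    · obtain ⟨i, hi⟩ := hodd
      rw [sum_signedPoints hN hQ, monomialAverage_of_odd hi, mul_zero]
      exact Finset.sum_eq_zero fun q _ =>
        Finset.prod_eq_zero (Finset.mem_univ i) (sum_signedSqrt_pow_odd _ hi)
    · simp only [not_exists, Nat.not_odd_iff_even, even_iff_two_dvd] at hodd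
      choose b hb using hodd
      obtain rfl : a = fun i => 2 * b i := funext hb
      rw [sum_signedPoints_even hN hQ, card_signedPoints hN hQ]
      exact h b (by rwa [Finset.mul_sum])

end

theorem exists_eq_add_single {d k : ℕ} {b : Fin d → ℕ} (hb : ∑ i, b i = k + 1) :
    ∃ (c : Fin d → ℕ) (i : Fin d), b = c + Pi.single i 1 ∧ ∑ j, c j = k := by
  obtain ⟨i, -, hi⟩ := Finset.exists_ne_zero_of_sum_ne_zero (by omega : ∑ i, b i ≠ 0)
  have he : b = (b - Pi.single i 1) + Pi.single i 1 := by
    funext j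
    rcases eq_or_ne j i with rfl | h
    · simp
      omega
    · simp [h]
  refine ⟨b - Pi.single i 1, i, he, ?_⟩
  rw [he] at hb
  simp only [Pi.add_apply, Finset.sum_add_distrib, Finset.sum_pi_single', Finset.mem_univ,
    if_true] at hb
  omega

/-! ### The two stiff configurations. -/

/-- The last basis vector of `ℝ⁸`, as a point of the sphere. -/
noncomputable def northPole : UnitSphere 8 :=
  ⟨EuclideanSpace.single 7 1, by rw [mem_sphere_zero_iff_norm, PiLp.norm_single, norm_one]⟩

theorem card_innerProducts_northPole_le {N : ℕ} {Q : Finset (Fin 8 → ℕ)} {T : Finset ℤ}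
    (h : ∀ q ∈ Q, (q 7 : ℤ) ∈ T ∧ -(q 7 : ℤ) ∈ T) :
    (innerProducts northPole (signedPoints N Q)).card ≤ T.card := by
  refine (Finset.card_le_card (t := T.image (signedSqrt N)) fun y hy => ?_).trans
    Finset.card_image_le
  obtain ⟨x, hx, rfl⟩ := Finset.mem_image.1 hy
  obtain ⟨s, hs, hxs⟩ := exists_of_mem_signedPoints hx
  obtain ⟨h1, h2⟩ := h _ (mem_signedVectors.1 hs)
  refine Finset.mem_image.2 ⟨s 7, ?_, ?_⟩
  · rcases Int.natAbs_eq (s 7) with h3 | h3 <;> rw [h3] <;> assumption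
  · rw [← hxs 7, northPole, EuclideanSpace.inner_single_left]
    simp

/-- The points are ± the first basis vector, both orthogonal to the pole. By sign symmetry only the
constant monomial needs checking. -/
theorem isStiff_one : IsStiff 1 (signedPoints 1 {(Pi.single 0 1 : Fin 8 → ℕ)}) := by
  refine ⟨one_pos, isSphericalDesign_signedPoints one_pos (by simp) (Finset.singleton_nonempty _)
    fun b hb => ?_, northPole, card_innerProducts_northPole_le (T := {0}) (by simp)⟩
  have hb0 : b = 0 := by
    have : ∑ i, b i = 0 := by omega
    exact funext fun i => Finset.sum_eq_zero_iff.1 this i (Finset.mem_univ i)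
  have := monomialAverage_zero (d := 8)
  subst hb0
  simp only [Pi.zero_apply, mul_zero, ← Pi.zero_def, this]
  simp

/-- The squared coordinates, multiplied by `30`, of a spherical `5`-design in `S⁷` whose last
coordinate takes three values. -/
def stiffRows : List (Fin 8 → ℕ) :=
  -- The last entry is forced: for `n = 1` the Gauss nodes are 0 and ±√(3/10), so it is 0 or 9. The
  -- pairs (8, 22) and (14, 16) have together the same sums, sums of squares and products as (10,
  -- 20) taken twice, but give distinct points. The three families contribute 448, 336 and 560
  -- points.
  ((List.finRange 7).map fun i => ![5, 5, 5, 5, 5, 5, 5, 0] - Pi.single i.castSucc 5) ++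
  ((List.finRange 7 ×ˢ List.finRange 7).filter fun p => p.1 ≠ p.2).flatMap (fun p =>
    [Pi.single p.1.castSucc 8 + Pi.single p.2.castSucc 22,
     Pi.single p.1.castSucc 14 + Pi.single p.2.castSucc 16]) ++
  ((List.finRange 7).sublistsLen 3).map fun s =>
    Pi.single 7 9 + (s.map fun i => (Pi.single i.castSucc 7 : Fin 8 → ℕ)).sum

theorem nodup_stiffRows : stiffRows.Nodup :=
  -- Rows are encoded in base 32, which exceeds every entry, so that distinctness is decided on
  -- natural numbers.
  List.Nodup.of_map (fun q : Fin 8 → ℕ => ∑ i, q i * 32 ^ (i : ℕ)) (by decide +kernel)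

/-- The list `stiffRows` as a finite set. -/
def stiffTable : Finset (Fin 8 → ℕ) := ⟨stiffRows, nodup_stiffRows⟩

theorem sum_stiffTable_eq (f : (Fin 8 → ℕ) → ℕ) :
    ∑ q ∈ stiffTable, f q = (stiffRows.map f).sum := rfl

theorem stiffTable_spec : ∀ q ∈ stiffTable, ∑ i, q i = 30 ∧ (q 7 = 0 ∨ q 7 = 9) := by
  have h : ∀ q ∈ stiffRows, ∑ i, q i = 30 ∧ (q 7 = 0 ∨ q 7 = 9) := by decide +kernel
  exact h

theorem stiffTable_moment_zero : ∑ q ∈ stiffTable, signCount q = 1344 := by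
  rw [sum_stiffTable_eq]
  decide +kernel

theorem stiffTable_moment_one (i : Fin 8) : ∑ q ∈ stiffTable, signCount q * q i = 5040 := by
  rw [sum_stiffTable_eq]
  revert i
  decide +kernel

theorem stiffTable_moment_two (i j : Fin 8) : ∑ q ∈ stiffTable, signCount q * (q i * q j) =
    if i = j then 45360 else 15120 := by
  rw [sum_stiffTable_eq]
  revert i j
  decide +kernel

theorem isStiff_three : IsStiff 3 (signedPoints 30 stiffTable) := by
  have hne : stiffTable.Nonempty := by
    rw [Finset.nonempty_iff_ne_empty]
    intro h
    have := stiffTable_moment_zero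
    simp [h] at this
  refine ⟨by norm_num, isSphericalDesign_signedPoints (by norm_num)
    (fun q hq => (stiffTable_spec q hq).1) hne
    fun b hb => ?_, northPole,
    (card_innerProducts_northPole_le (T := {0, 9, -9}) fun q hq => ?_ : _ ≤ 3)⟩
  · rw [stiffTable_moment_zero]
    -- Exponents are halved, so degree 5 leaves only moments of order at most two in the squared
    -- coordinates; their spherical values are 1, 1/8, and 3/80 or 1/80.
    have hb2 : ∑ i, b i ≤ 2 := by omega
    have hprod : ∀ (q c : Fin 8 → ℕ) (i : Fin 8),
        ∏ j, ((q j : ℝ) / (30 : ℕ)) ^ (c + Pi.single i 1 : Fin 8 → ℕ) j =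
          (∏ j, ((q j : ℝ) / (30 : ℕ)) ^ c j) * (q i / 30) := by
      intro q c i
      simp only [Pi.add_apply, pow_add, Finset.prod_mul_distrib]
      congr 1
      rw [Finset.prod_eq_single i (fun j _ hj => by simp [hj]) (by simp)]
      simp
    have havg : ∀ (c : Fin 8 → ℕ) (i : Fin 8),
        (2 * ∑ j, (c j : ℝ) + 8) *
          monomialAverage (fun j => 2 * (c + Pi.single i 1 : Fin 8 → ℕ) j) =
            (2 * c i + 1) * monomialAverage (fun j => 2 * c j) := by
      intro c i
      have h := monomialAverage_add_single (fun j => 2 * c j) i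
      push_cast [← Finset.mul_sum] at h
      rw [← h]
      congr 2
      funext j
      rcases eq_or_ne j i with rfl | hj
      · simp
        ring
      · simp [hj]
    have hzero : ∀ c : Fin 8 → ℕ, ∑ j, c j = 0 → c = 0 := fun c hc =>
      funext fun i => Finset.sum_eq_zero_iff.1 hc i (Finset.mem_univ i)
    have h0 : monomialAverage (fun j => 2 * (0 : Fin 8 → ℕ) j) = 1 := by
      simpa [← Pi.zero_def] using monomialAverage_zero (d := 8)
    have h1 : ∀ i, monomialAverage (fun j => 2 * (0 + Pi.single i 1 : Fin 8 → ℕ) j) = 1 / 8 := by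
      intro i
      have h := havg 0 i
      rw [h0] at h
      simp only [Pi.zero_apply, Nat.cast_zero, Finset.sum_const_zero] at h
      linarith
    rcases Nat.lt_or_ge 0 (∑ i, b i) with hpos | hpos
    · obtain ⟨c, i, rfl, hc⟩ := exists_eq_add_single (b := b) (k := ∑ i, b i - 1) (by omega)
      rcases Nat.lt_or_ge 0 (∑ i, c i) with hpos' | hpos'
      · obtain ⟨e, j, rfl, he⟩ := exists_eq_add_single (b := c) (k := 0) (by omega)
        obtain rfl := hzero e he
        have h2 := havg (0 + Pi.single j 1) i
        rw [h1] at h2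
        have h3 : ∑ k, (((0 + Pi.single j 1 : Fin 8 → ℕ) k : ℕ) : ℝ) = 1 := by
          rw [← Nat.cast_sum]
          simp
        rw [h3] at h2
        have h4 : ∑ q ∈ stiffTable, (signCount q : ℝ) * ((q i : ℝ) * q j) =
            (if i = j then 45360 else 15120 : ℕ) := by
          exact_mod_cast stiffTable_moment_two i j
        have h5 : ∀ q : Fin 8 → ℕ, (signCount q : ℝ) * (∏ k, ((q k : ℝ) / (30 : ℕ)) ^
            (0 + Pi.single j 1 + Pi.single i 1 : Fin 8 → ℕ) k) =
              signCount q * ((q i : ℝ) * q j) / 900 := by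
          intro q
          rw [hprod, hprod]
          simp only [Pi.zero_apply, pow_zero, Finset.prod_const_one]
          ring
        rw [Finset.sum_congr rfl fun q _ => h5 q, ← Finset.sum_div, h4]
        rcases eq_or_ne i j with rfl | hij
        · simp only [Pi.add_apply, Pi.zero_apply, Pi.single_eq_same, if_true] at h2 ⊢
          push_cast at h2 ⊢
          linarith
        · simp only [Pi.add_apply, Pi.zero_apply, Pi.single_eq_of_ne hij, if_neg hij] at h2 ⊢
          push_cast at h2 ⊢
          linarith
      · obtain rfl := hzero c (by omega)
        have h4 : ∑ q ∈ stiffTable, (signCount q : ℝ) * q i = 5040 := by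
          exact_mod_cast stiffTable_moment_one i
        have h5 : ∀ q : Fin 8 → ℕ, (signCount q : ℝ) * (∏ k, ((q k : ℝ) / (30 : ℕ)) ^
            (0 + Pi.single i 1 : Fin 8 → ℕ) k) = signCount q * (q i : ℝ) / 30 := by
          intro q
          rw [hprod]
          simp only [Pi.zero_apply, pow_zero, Finset.prod_const_one]
          ring
        rw [Finset.sum_congr rfl fun q _ => h5 q, ← Finset.sum_div, h4, h1]
        norm_num
    · obtain rfl := hzero b (by omega)
      have h4 : ∑ q ∈ stiffTable, (signCount q : ℝ) = 1344 := by
        exact_mod_cast stiffTable_moment_zero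
      rw [h0]
      simp only [Pi.zero_apply, pow_zero, Finset.prod_const_one, mul_one, h4]
      norm_num
  · rcases (stiffTable_spec q hq).2 with h | h <;> simp [h]

end

theorem mainTheorem10 (n : ℕ) :
    (∃ X : Finset (UnitSphere 8), IsStiff (2 * n + 1) X) ↔ (n = 0 ∨ n = 1) := by
  constructor
  · rintro ⟨Y, hY⟩
    have := le_one_of_isStiff hY
    omega
  · rintro (rfl | rfl)
    · exact ⟨_, isStiff_one⟩
    · exact ⟨_, isStiff_three⟩
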